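/- Let $d\ge 1$ be an integer and $\gamma>0$. For $f\in L^1(\mathbb R^d)$ put $\hat f(\xi)=(2\pi)^{-d/2}\int_{\mathbb R^d}e^{-i\xi\cdot x}f(x)\,dx$. For $a>0$, the Hardy class $E^d_{\mathcal F}(a)$ consists of all $f\in L^1(\mathbb R^d)\cap L^2(\mathbb R^d)$ for which there is a constant $A$ with $$|f(x)|\le A e^{-a|x|^2/2}\ \text{ for a.e. }x\in\mathbb R^d,\qquad |\hat f(\xi)|\le A e^{-a|\xi|^2/2}\ \text{ for all }\xi\in\mathbb R^d .$$ Then there is a constant $K>0$, depending only on $d$ and $\gamma$, such that the following holds. Let $u_0\in E^d_{\mathcal F}(\tanh 2\gamma)$ with constant $A$, and let $u\in C(\mathbb R;L^2(\mathbb R^d))$ be the solution of $$\frac1i\,\partial_t u(x,t)=(-\Delta+|x|^2)\,u(x,t),\qquad u(x,0)=u_0(x),$$ in the weak sense: for every Schwartz function $\varphi$ and every $t\in\mathbb R$, $\frac{d}{dt}\int u(x,t)\varphi(x)\,dx=i\int u(x,t)\,(-\Delta\varphi(x)+|x|^2\varphi(x))\,dx$. Then for every $t\in\mathbb R$, $$|u(x,t)|\le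 K A\,\max(1,|x|)^{\frac{d-1}{2d}}\,e^{-\tanh\left(\frac{\gamma}{d}\right)\frac{|x|^2}{2}}\qquad\text{for a.e. }x\in\mathbb R^d,$$ and moreover $u(\cdot,t)\in L^1(\mathbb R^d)$ and its Fourier transform $\hat u(\cdot,t)$ satisfies, for every $\xi\in\mathbb R^d$, $$|\hat u(\xi,t)|\le K A\,\max(1,|\xi|)^{\frac{d-1}{2d}}\,e^{-\tanh\left(\frac{\gamma}{d}\right)\frac{|\xi|^2}{2}} .$$ -/

import Mathlib

open MeasureTheory
open scoped Laplacian SchwartzMap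

/-- The Fourier transform with the unitary normalization in the angular frequency,
`(2π)^{-d/2} ∫ e^{-i ξ·x} f(x) dx`, for `f ∈ L¹(ℝᵈ)`. -/
noncomputable def unitaryFourier {d : ℕ} (f : EuclideanSpace ℝ (Fin d) → ℂ)
    (ξ : EuclideanSpace ℝ (Fin d)) : ℂ :=
  (((2 * Real.pi) ^ (-((d : ℝ) / 2)) : ℝ) : ℂ) *
    ∫ x, Complex.exp (-Complex.I * ((inner ℝ ξ x : ℝ) : ℂ)) * f x

/-- `f` lies in the Hardy class `E(a)` on `ℝᵈ` with constant `A`: `f ∈ L¹ ∩ L²`, and both `f`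
(almost everywhere) and its Fourier transform are bounded by `A e^{-a|x|²/2}`. The Hardy class
itself is the union of these sets over all `A`. -/
structure InHardyClass {d : ℕ} (a A : ℝ) (f : EuclideanSpace ℝ (Fin d) → ℂ) : Prop where
  integrable : Integrable f volume
  memLp_two : MemLp f 2 volume
  bound : ∀ᵐ x ∂volume, ‖f x‖ ≤ A * Real.exp (-(a * ‖x‖ ^ 2 / 2))
  fourier_bound : ∀ ξ, ‖unitaryFourier f ξ‖ ≤ A * Real.exp (-(a * ‖ξ‖ ^ 2 / 2))

/-- `u ∈ C(ℝ; L²(ℝᵈ))` is a weak solution of `(1/i) ∂ₜ u = (-Δ + |x|²) u`, `u(·, 0) = u₀`: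
for every Schwartz function `φ`,
`d/dt ∫ u(x,t) φ(x) dx = i ∫ u(x,t) (-Δφ(x) + |x|² φ(x)) dx` at every time `t ∈ ℝ`.
Here `u t` is the function `x ↦ u(x,t)`. -/
structure IsHarmonicSchrodingerSolution {d : ℕ} (u₀ : EuclideanSpace ℝ (Fin d) → ℂ)
    (u : ℝ → EuclideanSpace ℝ (Fin d) → ℂ) : Prop where
  memLp_two : ∀ t, MemLp (u t) 2 volume
  continuous_toLp : Continuous fun t => (memLp_two t).toLp (u t)
  initial : u 0 =ᵐ[volume] u₀
  weak_eq : ∀ (φ : 𝓢(EuclideanSpace ℝ (Fin d), ℂ)) (t : ℝ),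
    HasDerivAt (fun s => ∫ x, u s x * φ x)
      (Complex.I * ∫ x, u t x * (-(Δ (φ : EuclideanSpace ℝ (Fin d) → ℂ) x)
        + ((‖x‖ ^ 2 : ℝ) : ℂ) * φ x)) t

/-! The Bargmann transform F of a function turns the problem into one about growth of entire
functions. Put β = exp(-2γ). Gaussian decay at rate `tanh 2γ` of u₀ and of its Fourier transform
becomes |F(z)| ≤ M exp((β²|Re z|² + |Im z|²)/4) together with the same bound with the real and
imaginary parts exchanged, because the Fourier transform acts on F by z ↦ -iz. The harmonic flow
acts by z ↦ exp(-2it)z up to a unimodular factor (`IsHarmonicSchrodingerSolution.norm_bargmann`), so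
every time, and the Fourier transform at every time, is covered by a bound on F along all rotations.

Conversely, if |F(z)| ≤ M exp((b|Re z|² + κ|Im z|²)/4) with κ < 1, Fourier inversion on the slices
Re z = s, followed by minimization over s, returns decay at rate (1-b)/(1+b), which is `tanh g` for
b = exp(-2g) (`norm_le_of_bargmann_bound`). Only b affects the rate; κ enters the constant alone. It
thus suffices to reach b = exp(-2γ/d) on all rotations with some κ < 1.

On a complex multiple of a real vector, Phragmén–Lindelöf improves the two given bounds to M
exp(β|z|²/4) (`norm_le_of_quadratic_bounds`). For d = 1 every vector is of this kind. For d ≥ 2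
there is slack: exp(-2γ/d) ≥ ρ = exp(-γ), while β = ρ². If ρ is small, the maximum principle on a
disc bounded by multiples of real vectors gives coefficients 8β/5 and 8β/3; if ρ is near 1,
combining the two original bounds gives (1+β²)/2 ≤ ρ. Both are summed up in
`exists_norm_bargmann_rotated_le`. The polynomial factor in the theorem is then not needed: it is at
least 1. -/

/-- The real part of a complex vector, as a Euclidean vector. -/
noncomputable def reVec {d : ℕ} (z : Fin d → ℂ) : EuclideanSpace ℝ (Fin d) :=
  WithLp.toLp 2 fun j => (z j).re

/-- The imaginary part of a complex vector, as a Euclidean vector. -/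
noncomputable def imVec {d : ℕ} (z : Fin d → ℂ) : EuclideanSpace ℝ (Fin d) :=
  WithLp.toLp 2 fun j => (z j).im

/-- The bilinear product `z · x` of a complex vector with a real one. -/
noncomputable def cdot {d : ℕ} (z : Fin d → ℂ) (x : EuclideanSpace ℝ (Fin d)) : ℂ :=
  ∑ j, z j * (x j : ℂ)

/-- The (scaled) Bargmann kernel `exp (z · x - |x|² / 2 - z · z / 4)`. -/
noncomputable def coherent {d : ℕ} (z : Fin d → ℂ) (x : EuclideanSpace ℝ (Fin d)) : ℂ :=
  Complex.exp (cdot z x - (‖x‖ : ℂ) ^ 2 / 2 - (∑ j, z j ^ 2) / 4)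

/-- The (scaled) Bargmann transform. -/
noncomputable def bargmann {d : ℕ} (f : EuclideanSpace ℝ (Fin d) → ℂ) (z : Fin d → ℂ) : ℂ :=
  ∫ x, f x * coherent z x

/-! ### The Bargmann kernel: size, Gaussian integrals and Fourier transform. -/

section Kernel

variable {d : ℕ}

theorem norm_sq_reVec (z : Fin d → ℂ) : ‖reVec z‖ ^ 2 = ∑ j, (z j).re ^ 2 := by
  simp [reVec, EuclideanSpace.norm_sq_eq]

theorem norm_sq_imVec (z : Fin d → ℂ) : ‖imVec z‖ ^ 2 = ∑ j, (z j).im ^ 2 := by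
  simp [imVec, EuclideanSpace.norm_sq_eq]

theorem norm_sq_reVec_add_imVec (z : Fin d → ℂ) :
    ‖reVec z‖ ^ 2 + ‖imVec z‖ ^ 2 = ∑ j, ‖z j‖ ^ 2 := by
  rw [norm_sq_reVec, norm_sq_imVec, ← Finset.sum_add_distrib]
  refine Finset.sum_congr rfl fun j _ => ?_
  rw [Complex.sq_norm, Complex.normSq_apply]; ring

theorem cdot_re (z : Fin d → ℂ) (x : EuclideanSpace ℝ (Fin d)) :
    (cdot z x).re = inner ℝ (reVec z) x := by
  simp [cdot, reVec, PiLp.inner_apply, mul_comm]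

theorem cdot_im (z : Fin d → ℂ) (x : EuclideanSpace ℝ (Fin d)) :
    (cdot z x).im = inner ℝ (imVec z) x := by
  simp [cdot, imVec, PiLp.inner_apply, mul_comm]

theorem sum_sq_re (z : Fin d → ℂ) : (∑ j, z j ^ 2).re = ‖reVec z‖ ^ 2 - ‖imVec z‖ ^ 2 := by
  rw [norm_sq_reVec, norm_sq_imVec, ← Finset.sum_sub_distrib, Complex.re_sum]
  refine Finset.sum_congr rfl fun j _ => ?_
  rw [pow_two, Complex.mul_re]; ring

theorem norm_coherent (z : Fin d → ℂ) (x : EuclideanSpace ℝ (Fin d)) :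
    ‖coherent z x‖ = Real.exp (inner ℝ (reVec z) x - ‖x‖ ^ 2 / 2
      - (‖reVec z‖ ^ 2 - ‖imVec z‖ ^ 2) / 4) := by
  have h1 : ((‖x‖ : ℂ) ^ 2 / 2).re = ‖x‖ ^ 2 / 2 := by
    rw [show ((‖x‖ : ℂ) ^ 2 / 2) = ((‖x‖ ^ 2 / 2 : ℝ) : ℂ) by push_cast; ring, Complex.ofReal_re]
  have h2 : ((∑ j, z j ^ 2) / 4).re = (∑ j, z j ^ 2).re / 4 := by
    rw [show ((∑ j, z j ^ 2) / 4) = (∑ j, z j ^ 2) / ((4 : ℝ) : ℂ) by push_cast; ring,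
      Complex.div_ofReal_re]
  rw [coherent, Complex.norm_exp, Complex.sub_re, Complex.sub_re, h1, h2, sum_sq_re, cdot_re]

theorem norm_cdot_le (z : Fin d → ℂ) (x : EuclideanSpace ℝ (Fin d)) :
    ‖cdot z x‖ ≤ (∑ j, ‖z j‖) * ‖x‖ := by
  rw [cdot, Finset.sum_mul]
  refine (norm_sum_le _ _).trans (Finset.sum_le_sum fun j _ => ?_)
  rw [norm_mul, Complex.norm_real]
  exact mul_le_mul_of_nonneg_left (PiLp.norm_apply_le x j) (norm_nonneg _)

theorem norm_sum_mul_le (z w : Fin d → ℂ) :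
    ‖∑ j, z j * w j‖ ≤ (∑ j, ‖z j‖) * ∑ j, ‖w j‖ := by
  rw [Finset.sum_mul]
  refine (norm_sum_le _ _).trans (Finset.sum_le_sum fun j _ => ?_)
  rw [norm_mul]
  exact mul_le_mul_of_nonneg_left
    (Finset.single_le_sum (f := fun j => ‖w j‖) (fun i _ => norm_nonneg _) (Finset.mem_univ j))
    (norm_nonneg _)

/-- Uniform over all z with Σ|z_j| ≤ S, a set stable under rotation of z, so it can serve as a
dominating function when z varies. -/
theorem norm_coherent_le {S : ℝ} (z : Fin d → ℂ) (hS : ∑ j, ‖z j‖ ≤ S)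
    (x : EuclideanSpace ℝ (Fin d)) :
    ‖coherent z x‖ ≤ Real.exp (S * ‖x‖ - ‖x‖ ^ 2 / 2 + S ^ 2 / 4) := by
  have h0 : 0 ≤ ∑ j, ‖z j‖ := Finset.sum_nonneg fun j _ => norm_nonneg _
  have h1 : (cdot z x).re ≤ S * ‖x‖ := (Complex.re_le_norm _).trans
    ((norm_cdot_le z x).trans (mul_le_mul_of_nonneg_right hS (norm_nonneg _)))
  have h2 : -(∑ j, z j ^ 2).re ≤ S ^ 2 := by
    refine (neg_le_abs _).trans ((Complex.abs_re_le_norm _).trans ?_)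
    simp only [pow_two]
    exact (norm_sum_mul_le z z).trans (mul_le_mul hS hS h0 (h0.trans hS))
  rw [norm_coherent, ← cdot_re, ← sum_sq_re]
  exact Real.exp_le_exp.2 (by linarith)

@[fun_prop]
theorem continuous_cdot (z : Fin d → ℂ) : Continuous (cdot z) := by
  unfold cdot; fun_prop

@[fun_prop]
theorem continuous_coherent (z : Fin d → ℂ) : Continuous (coherent z) := by
  unfold coherent; fun_prop

theorem integrable_exp_quadratic {b : ℝ} (hb : 0 < b) (s : EuclideanSpace ℝ (Fin d)) :
    Integrable fun x : EuclideanSpace ℝ (Fin d) => Real.exp (-b * ‖x‖ ^ 2 + inner ℝ s x) := by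
  have h := (GaussianFourier.integrable_cexp_neg_mul_sq_norm_add (b := (b : ℂ)) (by simpa using hb)
    1 s).norm
  refine h.congr (Filter.Eventually.of_forall fun x => ?_)
  simp only [Complex.norm_exp]
  congr 1
  rw [show (-(b : ℂ) * (‖x‖ : ℂ) ^ 2 + 1 * ((inner ℝ s x : ℝ) : ℂ)) =
    ((-b * ‖x‖ ^ 2 + inner ℝ s x : ℝ) : ℂ) by push_cast; ring, Complex.ofReal_re]

theorem integral_exp_quadratic {b : ℝ} (hb : 0 < b) (s : EuclideanSpace ℝ (Fin d)) :
    ∫ x : EuclideanSpace ℝ (Fin d), Real.exp (-b * ‖x‖ ^ 2 + inner ℝ s x)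
      = (Real.pi / b) ^ ((d : ℝ) / 2) * Real.exp (‖s‖ ^ 2 / (4 * b)) := by
  have h := GaussianFourier.integral_cexp_neg_mul_sq_norm_add (b := (b : ℂ)) (by simpa using hb)
    1 s
  have hpi : 0 ≤ Real.pi / b := by positivity
  have e : ∀ x : EuclideanSpace ℝ (Fin d),
      Complex.exp (-(b : ℂ) * (‖x‖ : ℂ) ^ 2 + 1 * ((inner ℝ s x : ℝ) : ℂ)) =
        ((Real.exp (-b * ‖x‖ ^ 2 + inner ℝ s x) : ℝ) : ℂ) := fun x => by push_cast; ring_nf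
  simp only [e] at h
  rw [integral_complex_ofReal, finrank_euclideanSpace_fin] at h
  have h2 : ((Real.pi : ℂ) / (b : ℂ)) ^ ((d : ℂ) / 2) * Complex.exp (1 ^ 2 * (‖s‖ : ℂ) ^ 2 / (4 * b))
      = (((Real.pi / b) ^ ((d : ℝ) / 2) * Real.exp (‖s‖ ^ 2 / (4 * b)) : ℝ) : ℂ) := by
    push_cast [Complex.ofReal_cpow hpi]; ring_nf
  rw [h2] at h
  exact_mod_cast h

theorem integrable_exp_neg_mul_norm_sq {b : ℝ} (hb : 0 < b) :
    Integrable fun x : EuclideanSpace ℝ (Fin d) => Real.exp (-b * ‖x‖ ^ 2) := by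
  simpa using integrable_exp_quadratic (d := d) hb 0

theorem linear_sub_sq_le (S r : ℝ) : S * r - r ^ 2 / 2 ≤ S ^ 2 - r ^ 2 / 4 := by
  nlinarith [sq_nonneg (S - r / 2)]

/-- A Gaussian majorant of the kernel. -/
theorem norm_coherent_le_gaussian {S : ℝ} (z : Fin d → ℂ) (hS : ∑ j, ‖z j‖ ≤ S)
    (x : EuclideanSpace ℝ (Fin d)) :
    ‖coherent z x‖ ≤ Real.exp (2 * S ^ 2) * Real.exp (-(1 / 4) * ‖x‖ ^ 2) := by
  refine (norm_coherent_le z hS x).trans ?_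
  rw [← Real.exp_add]
  exact Real.exp_le_exp.2 (by nlinarith [linear_sub_sq_le S ‖x‖, sq_nonneg S])

theorem integrable_coherent (z : Fin d → ℂ) : Integrable (coherent z) :=
  ((integrable_exp_neg_mul_norm_sq (d := d) (b := 1 / 4) (by norm_num)).const_mul
    (Real.exp (2 * (∑ j, ‖z j‖) ^ 2))).mono' (continuous_coherent z).aestronglyMeasurable
    (Filter.Eventually.of_forall fun x => norm_coherent_le_gaussian z le_rfl x)

theorem exists_norm_coherent_le (z : Fin d → ℂ) : ∃ C, ∀ x, ‖coherent z x‖ ≤ C :=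
  ⟨Real.exp (2 * (∑ j, ‖z j‖) ^ 2), fun x => (norm_coherent_le_gaussian z le_rfl x).trans
    (mul_le_of_le_one_right (Real.exp_pos _).le (Real.exp_le_one_iff.2
      (by nlinarith [sq_nonneg ‖x‖])))⟩

theorem MeasureTheory.Integrable.mul_coherent {f : EuclideanSpace ℝ (Fin d) → ℂ}
    (hf : Integrable f) (z : Fin d → ℂ) : Integrable fun x => f x * coherent z x := by
  obtain ⟨C, hC⟩ := exists_norm_coherent_le z
  exact hf.mul_bdd (c := C) (continuous_coherent z).aestronglyMeasurable
    (Filter.Eventually.of_forall hC)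

/-- The Bargmann transform of a function with Gaussian decay. -/
theorem norm_bargmann_le {a A : ℝ} (ha : -1 < a) {f : EuclideanSpace ℝ (Fin d) → ℂ}
    (hf : ∀ᵐ x, ‖f x‖ ≤ A * Real.exp (-(a * ‖x‖ ^ 2 / 2))) (z : Fin d → ℂ) :
    ‖bargmann f z‖ ≤ (2 * Real.pi / (1 + a)) ^ ((d : ℝ) / 2) * A *
      Real.exp (‖reVec z‖ ^ 2 / (2 * (1 + a)) - (‖reVec z‖ ^ 2 - ‖imVec z‖ ^ 2) / 4) := by
  have hb : 0 < (1 + a) / 2 := by linarith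
  have hb' : 0 < 1 + a := by linarith
  have hle : ∀ᵐ x, ‖f x * coherent z x‖ ≤
      A * Real.exp (-(‖reVec z‖ ^ 2 - ‖imVec z‖ ^ 2) / 4) *
        Real.exp (-((1 + a) / 2) * ‖x‖ ^ 2 + inner ℝ (reVec z) x) := by
    filter_upwards [hf] with x hx
    rw [norm_mul, norm_coherent]
    refine (mul_le_mul_of_nonneg_right hx (Real.exp_pos _).le).trans (le_of_eq ?_)
    rw [mul_assoc, mul_assoc, ← Real.exp_add, ← Real.exp_add]
    ring_nf
  refine (norm_integral_le_of_norm_le ((integrable_exp_quadratic hb _).const_mul _) hle).trans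
    (le_of_eq ?_)
  rw [integral_const_mul, integral_exp_quadratic hb]
  rw [show Real.pi / ((1 + a) / 2) = 2 * Real.pi / (1 + a) by field_simp]
  rw [show ‖reVec z‖ ^ 2 / (2 * (1 + a)) - (‖reVec z‖ ^ 2 - ‖imVec z‖ ^ 2) / 4 =
    -(‖reVec z‖ ^ 2 - ‖imVec z‖ ^ 2) / 4 + ‖reVec z‖ ^ 2 / (4 * ((1 + a) / 2)) by
      field_simp; ring, Real.exp_add]
  ring

theorem continuous_unitaryFourier {f : EuclideanSpace ℝ (Fin d) → ℂ} (hf : Integrable f) :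
    Continuous (unitaryFourier f) := by
  unfold unitaryFourier
  refine continuous_const.mul (continuous_of_dominated (bound := fun x => ‖f x‖) ?_ ?_ hf.norm ?_)
  · intro ξ
    exact (Continuous.aestronglyMeasurable (by fun_prop)).mul hf.aestronglyMeasurable
  · intro ξ
    refine Filter.Eventually.of_forall fun x => ?_
    rw [norm_mul, Complex.norm_exp]
    simp
  · refine Filter.Eventually.of_forall fun x => ?_
    fun_prop

/-- The unitary Fourier transform acts on the Bargmann kernel by `z ↦ -iz`. -/
theorem unitaryFourier_coherent (z : Fin d → ℂ) (ξ : EuclideanSpace ℝ (Fin d)) :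
    unitaryFourier (coherent z) ξ = coherent (fun j => -Complex.I * z j) ξ := by
  have h := GaussianFourier.integral_cexp_neg_mul_sum_add (ι := Fin d) (b := 1 / 2) (by norm_num)
    (fun j => z j - Complex.I * (ξ j : ℂ))
  have e : ∫ x, Complex.exp (-Complex.I * ((inner ℝ ξ x : ℝ) : ℂ)) * coherent z x =
      Complex.exp (-(∑ j, z j ^ 2) / 4) * ∫ v : Fin d → ℝ,
        Complex.exp (-(1 / 2) * ∑ i, (v i : ℂ) ^ 2 + ∑ j, (z j - Complex.I * (ξ j : ℂ)) * v j) := by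
    rw [← (EuclideanSpace.volume_preserving_symm_measurableEquiv_toLp (Fin d)).integral_comp'
      , ← integral_const_mul]
    refine integral_congr_ae (Filter.Eventually.of_forall fun x => ?_)
    simp only [coherent]
    rw [← Complex.exp_add, ← Complex.exp_add]
    congr 1
    have h1 : ((‖x‖ : ℂ)) ^ 2 = ∑ j, (x j : ℂ) ^ 2 := by
      have := EuclideanSpace.norm_sq_eq x
      simp only [Real.norm_eq_abs, sq_abs] at this
      exact_mod_cast this
    have h2 : ((inner ℝ ξ x : ℝ) : ℂ) = ∑ j, (ξ j : ℂ) * (x j : ℂ) := by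
      simp [PiLp.inner_apply, mul_comm]
    have h3 : ∑ j, (z j - Complex.I * (ξ j : ℂ)) * (x j : ℂ) =
        ∑ j, z j * (x j : ℂ) - Complex.I * ∑ j, (ξ j : ℂ) * (x j : ℂ) := by
      rw [Finset.mul_sum, ← Finset.sum_sub_distrib]
      exact Finset.sum_congr rfl fun j _ => by ring
    change _ = _ + (-(1 / 2) * ∑ j, (x j : ℂ) ^ 2 +
      ∑ j, (z j - Complex.I * (ξ j : ℂ)) * (x j : ℂ))
    rw [h1, h2, h3, cdot]
    ring
  -- The unitary normalization exactly cancels the Gaussian integral (2π)^(d/2).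
  have hc : ((((2 * Real.pi) ^ (-((d : ℝ) / 2)) : ℝ)) : ℂ) *
      ((Real.pi : ℂ) / (1 / 2)) ^ ((Fintype.card (Fin d) : ℂ) / 2) = 1 := by
    have : ((Real.pi : ℂ) / (1 / 2)) ^ ((Fintype.card (Fin d) : ℂ) / 2) =
        (((2 * Real.pi) ^ ((d : ℝ) / 2) : ℝ) : ℂ) := by
      rw [Complex.ofReal_cpow (by positivity)]
      push_cast
      simp only [Fintype.card_fin]
      congr 1
      ring
    rw [this, ← Complex.ofReal_mul, ← Real.rpow_add (by positivity)]
    simp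
  rw [unitaryFourier, e, h, mul_left_comm, ← mul_assoc _ _ (Complex.exp _), hc, one_mul,
    ← Complex.exp_add, coherent]
  congr 1
  have h1 : ((‖ξ‖ : ℂ)) ^ 2 = ∑ j, (ξ j : ℂ) ^ 2 := by
    have := EuclideanSpace.norm_sq_eq ξ
    simp only [Real.norm_eq_abs, sq_abs] at this
    exact_mod_cast this
  have h2 : ∑ j, (z j - Complex.I * (ξ j : ℂ)) ^ 2 =
      ∑ j, z j ^ 2 - 2 * Complex.I * ∑ j, z j * (ξ j : ℂ) - ∑ j, (ξ j : ℂ) ^ 2 := by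
    rw [Finset.mul_sum, ← Finset.sum_sub_distrib, ← Finset.sum_sub_distrib]
    refine Finset.sum_congr rfl fun j _ => ?_
    linear_combination (ξ j : ℂ) ^ 2 * Complex.I_sq
  have h3 : ∑ j, (-Complex.I * z j) ^ 2 = -∑ j, z j ^ 2 := by
    rw [← Finset.sum_neg_distrib]
    refine Finset.sum_congr rfl fun j _ => ?_
    linear_combination z j ^ 2 * Complex.I_sq
  have h4 : ∑ j, -Complex.I * z j * (ξ j : ℂ) = -Complex.I * ∑ j, z j * (ξ j : ℂ) := by
    rw [Finset.mul_sum]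
    exact Finset.sum_congr rfl fun j _ => by ring
  rw [h1, cdot, h2, h3, h4]
  ring

/-- Fubini moves the Fourier transform onto the kernel, where it is the substitution z ↦ -iz. -/
theorem bargmann_unitaryFourier {f : EuclideanSpace ℝ (Fin d) → ℂ} (hf : Integrable f)
    (z : Fin d → ℂ) :
    bargmann (unitaryFourier f) z = bargmann f (fun j => -Complex.I * z j) := by
  have hprod : Integrable (fun p : EuclideanSpace ℝ (Fin d) × EuclideanSpace ℝ (Fin d) =>
      Complex.exp (-Complex.I * ((inner ℝ p.1 p.2 : ℝ) : ℂ)) * (coherent z p.1 * f p.2))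
      (volume.prod volume) := by
    refine ((integrable_coherent z).mul_prod hf).bdd_mul (c := 1)
      (Continuous.aestronglyMeasurable (by fun_prop)) (Filter.Eventually.of_forall fun p => ?_)
    rw [Complex.norm_exp]
    simp
  have h := integral_integral_swap (f := fun x y : EuclideanSpace ℝ (Fin d) =>
    Complex.exp (-Complex.I * ((inner ℝ x y : ℝ) : ℂ)) * (coherent z x * f y)) hprod
  simp only [bargmann]
  simp_rw [← unitaryFourier_coherent, unitaryFourier]
  calc ∫ x, ↑((2 * Real.pi) ^ (-((d : ℝ) / 2))) *
          (∫ y, Complex.exp (-Complex.I * ((inner ℝ x y : ℝ) : ℂ)) * f y) * coherent z x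
      = ↑((2 * Real.pi) ^ (-((d : ℝ) / 2))) * ∫ x, ∫ y,
          Complex.exp (-Complex.I * ((inner ℝ x y : ℝ) : ℂ)) * (coherent z x * f y) := by
        rw [← integral_const_mul]
        refine integral_congr_ae (Filter.Eventually.of_forall fun x => ?_)
        simp only
        rw [mul_assoc, ← integral_mul_const]
        congr 2
        ext y
        ring
    _ = _ := by
        rw [h, ← integral_const_mul]
        refine integral_congr_ae (Filter.Eventually.of_forall fun x => ?_)
        simp only
        rw [mul_left_comm]
        congr 1
        rw [← integral_const_mul]
        congr 1
        ext y
        rw [real_inner_comm]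
        ring

end Kernel

/-! ### Phragmén–Lindelöf for Gaussian growth in one complex variable. -/

section PhragmenLindelof

open Complex in
/-- On the sector `β x ≤ y`, `β y ≤ x`, an entire function with
`|f| ≤ M exp (k (β² x² + y²))` and `|f| ≤ M exp (k (x² + β² y²))` is at most
`M exp (k β |w|²)`. -/
theorem norm_exp_le_of_quadratic_bounds {f : ℂ → ℂ} (hf : Differentiable ℂ f) {M k β : ℝ}
    (hk : 0 ≤ k) (hβ : 0 < β) (hβ1 : β < 1)
    (h₁ : ∀ w, ‖f w‖ ≤ M * Real.exp (k * (β ^ 2 * w.re ^ 2 + w.im ^ 2)))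
    (h₂ : ∀ w, ‖f w‖ ≤ M * Real.exp (k * (w.re ^ 2 + β ^ 2 * w.im ^ 2)))
    {ζ : ℂ} (ha : Real.arctan β ≤ ζ.im) (hb : ζ.im ≤ Real.pi / 2 - Real.arctan β) :
    ‖f (exp ζ)‖ ≤ M * Real.exp (k * β * ‖exp ζ‖ ^ 2) := by
  have hM : 0 ≤ M := by
    by_contra h
    push Not at h
    have := (norm_nonneg _).trans (h₁ 0)
    nlinarith [Real.exp_pos (k * (β ^ 2 * (0 : ℂ).re ^ 2 + (0 : ℂ).im ^ 2))]
  set a := Real.arctan β with ha_def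
  have ha0 : 0 < a := Real.arctan_pos.2 hβ
  have ha4 : a < Real.pi / 4 := by
    rw [← Real.arctan_one]; exact Real.arctan_strictMono hβ1
  have hD : 0 < 1 + β ^ 2 := by positivity
  have hcos : Real.cos a ^ 2 = 1 / (1 + β ^ 2) := Real.cos_sq_arctan β
  have hsin : Real.sin a ^ 2 = β ^ 2 / (1 + β ^ 2) := by
    rw [Real.sin_sq, hcos]; field_simp; ring
  have hsc : Real.sin a * Real.cos a = β / (1 + β ^ 2) := by
    rw [ha_def, Real.sin_arctan, Real.cos_arctan, div_mul_div_comm, mul_one,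
      Real.mul_self_sqrt hD.le]
  have hsin2 : Real.sin (2 * a) = 2 * β / (1 + β ^ 2) := by
    rw [Real.sin_two_mul, mul_assoc, hsc]; ring
  -- With w = exp ζ the sector becomes a horizontal strip and the multiplier is exp(ikβw²), of
  -- modulus exp(-kβ|w|² sin 2θ) with θ = arg w.
  set g : ℂ → ℂ := fun ζ => f (exp ζ) * exp (I * (k * β) * exp (2 * ζ)) with hg
  have hnorm : ∀ ζ : ℂ, ‖exp (I * (k * β) * exp (2 * ζ))‖ =
      Real.exp (-(k * β) * (Real.exp ζ.re ^ 2 * Real.sin (2 * ζ.im))) := by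
    intro ζ
    rw [norm_exp]
    congr 1
    have h3 : (exp (2 * ζ)).im = Real.exp ζ.re ^ 2 * Real.sin (2 * ζ.im) := by
      rw [exp_im, ← Real.exp_nat_mul]; simp
    rw [← h3]
    simp [mul_re, mul_im]
  have hre : ∀ ζ : ℂ, (exp ζ).re ^ 2 = Real.exp ζ.re ^ 2 * Real.cos ζ.im ^ 2 := fun ζ => by
    rw [exp_re]; ring
  have him : ∀ ζ : ℂ, (exp ζ).im ^ 2 = Real.exp ζ.re ^ 2 * Real.sin ζ.im ^ 2 := fun ζ => by
    rw [exp_im]; ring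
  have hgM : ‖g ζ‖ ≤ M := by
    refine PhragmenLindelof.horizontal_strip (a := a) (b := Real.pi / 2 - a) (f := g) ?_ ?_ ?_ ?_
      ha hb
    · refine Differentiable.diffContOnCl ?_
      exact (hf.comp differentiable_exp).mul (by fun_prop)
    · refine ⟨2, ?_, k * 2, ?_⟩
      -- The strip has width π/2 - 2a < π/2, so the quadratic growth in w, of order 2 in the
      -- exponential coordinate, is strictly below the critical order.
      · rw [lt_div_iff₀ (by linarith)]; linarith
      · refine Asymptotics.IsBigO.of_bound M (Filter.Eventually.of_forall fun z => ?_)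
        rw [hg, norm_mul, hnorm, Real.norm_of_nonneg (Real.exp_pos _).le]
        have e1 : Real.exp z.re ^ 2 ≤ Real.exp (2 * |z.re|) := by
          rw [← Real.exp_nat_mul]
          exact Real.exp_le_exp.2 (by push_cast; linarith [le_abs_self z.re])
        have e2 : β ^ 2 * (exp z).re ^ 2 + (exp z).im ^ 2 ≤ Real.exp z.re ^ 2 := by
          rw [hre, him]
          have := Real.sin_sq_add_cos_sq z.im
          have hb2 : β ^ 2 ≤ 1 := by nlinarith
          nlinarith [mul_nonneg (sq_nonneg (Real.exp z.re)) (sq_nonneg (Real.cos z.im)),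
            mul_nonneg (sub_nonneg.2 hb2)
              (mul_nonneg (sq_nonneg (Real.exp z.re)) (sq_nonneg (Real.cos z.im)))]
        have e3 : -(k * β) * (Real.exp z.re ^ 2 * Real.sin (2 * z.im)) ≤
            k * Real.exp z.re ^ 2 := by
          have h5 : -(β * Real.sin (2 * z.im)) ≤ 1 := by
            nlinarith [Real.neg_one_le_sin (2 * z.im)]
          have := mul_le_mul_of_nonneg_left h5 (mul_nonneg hk (sq_nonneg (Real.exp z.re)))
          linarith
        calc ‖f (exp z)‖ * Real.exp (-(k * β) * (Real.exp z.re ^ 2 * Real.sin (2 * z.im)))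
            ≤ M * Real.exp (k * Real.exp z.re ^ 2) * Real.exp (k * Real.exp z.re ^ 2) := by
              refine mul_le_mul ((h₁ _).trans (mul_le_mul_of_nonneg_left (Real.exp_le_exp.2
                (mul_le_mul_of_nonneg_left e2 hk)) hM)) (Real.exp_le_exp.2 e3)
                (Real.exp_pos _).le (by positivity)
          _ ≤ M * Real.exp (k * 2 * Real.exp (2 * |z.re|)) := by
              rw [mul_assoc, ← Real.exp_add]
              refine mul_le_mul_of_nonneg_left (Real.exp_le_exp.2 ?_) hM
              nlinarith [mul_le_mul_of_nonneg_left e1 hk]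
    -- The slope of the edge is chosen so that the exponents cancel: at θ = arctan β both β²cos²θ +
    -- sin²θ and β sin 2θ equal 2β²/(1+β²).
    · intro z hz
      rw [hg, norm_mul, hnorm]
      refine (mul_le_mul_of_nonneg_right (h₁ _) (Real.exp_pos _).le).trans (le_of_eq ?_)
      rw [mul_assoc, ← Real.exp_add, hre, him, hz, hcos, hsin, hsin2]
      conv_rhs => rw [← mul_one M, ← Real.exp_zero]
      congr 2
      field_simp
      ring
    · intro z hz
      rw [hg, norm_mul, hnorm]
      refine (mul_le_mul_of_nonneg_right (h₂ _) (Real.exp_pos _).le).trans (le_of_eq ?_)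
      rw [mul_assoc, ← Real.exp_add, hre, him, hz, Real.cos_pi_div_two_sub,
        Real.sin_pi_div_two_sub, show 2 * (Real.pi / 2 - a) = Real.pi - 2 * a by ring,
        Real.sin_pi_sub, hcos, hsin, hsin2]
      conv_rhs => rw [← mul_one M, ← Real.exp_zero]
      congr 2
      field_simp
      ring
  rw [hg, norm_mul, hnorm] at hgM
  have h6 : ‖f (exp ζ)‖ ≤
      M * Real.exp (k * β * (Real.exp ζ.re ^ 2 * Real.sin (2 * ζ.im))) := by
    calc ‖f (exp ζ)‖ = ‖f (exp ζ)‖ *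
          Real.exp (-(k * β) * (Real.exp ζ.re ^ 2 * Real.sin (2 * ζ.im))) *
          Real.exp (k * β * (Real.exp ζ.re ^ 2 * Real.sin (2 * ζ.im))) := by
          rw [mul_assoc, ← Real.exp_add]; simp
      _ ≤ _ := mul_le_mul_of_nonneg_right hgM (Real.exp_pos _).le
  refine h6.trans (mul_le_mul_of_nonneg_left (Real.exp_le_exp.2 ?_) hM)
  rw [norm_exp]
  refine mul_le_mul_of_nonneg_left ?_ (by positivity)
  exact mul_le_of_le_one_right (by positivity) (Real.sin_le_one _)

-- Near each axis, where one coordinate is at most β times the other, one hypothesis already implies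
-- the bound since β² ≤ β. The sector in between is the Phragmén–Lindelöf case, taken at ζ = log w.
open Complex in
theorem norm_le_of_quadratic_bounds_quadrant {f : ℂ → ℂ} (hf : Differentiable ℂ f) {M k β : ℝ}
    (hk : 0 ≤ k) (hβ : 0 < β) (hβ1 : β < 1)
    (h₁ : ∀ w, ‖f w‖ ≤ M * Real.exp (k * (β ^ 2 * w.re ^ 2 + w.im ^ 2)))
    (h₂ : ∀ w, ‖f w‖ ≤ M * Real.exp (k * (w.re ^ 2 + β ^ 2 * w.im ^ 2)))
    {w : ℂ} (hre : 0 ≤ w.re) (him : 0 ≤ w.im) :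
    ‖f w‖ ≤ M * Real.exp (k * β * ‖w‖ ^ 2) := by
  have hM : 0 ≤ M := by
    by_contra h
    push Not at h
    have := (norm_nonneg _).trans (h₁ 0)
    nlinarith [Real.exp_pos (k * (β ^ 2 * (0 : ℂ).re ^ 2 + (0 : ℂ).im ^ 2))]
  have hn : ‖w‖ ^ 2 = w.re ^ 2 + w.im ^ 2 := by
    rw [Complex.sq_norm, Complex.normSq_apply]; ring
  by_cases hx : w.im ≤ β * w.re
  · refine (h₁ w).trans (mul_le_mul_of_nonneg_left (Real.exp_le_exp.2 ?_) hM)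
    rw [hn, mul_assoc]
    refine mul_le_mul_of_nonneg_left ?_ hk
    have h3 : w.im ^ 2 ≤ (β * w.re) ^ 2 := pow_le_pow_left₀ him hx 2
    have h4 : 0 ≤ β * (1 - β) * w.re ^ 2 := by
      have : 0 < 1 - β := by linarith
      positivity
    nlinarith
  by_cases hy : w.re ≤ β * w.im
  · refine (h₂ w).trans (mul_le_mul_of_nonneg_left (Real.exp_le_exp.2 ?_) hM)
    rw [hn, mul_assoc]
    refine mul_le_mul_of_nonneg_left ?_ hk
    have h3 : w.re ^ 2 ≤ (β * w.im) ^ 2 := pow_le_pow_left₀ hre hy 2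
    have h4 : 0 ≤ β * (1 - β) * w.im ^ 2 := by
      have : 0 < 1 - β := by linarith
      positivity
    nlinarith
  push Not at hx hy
  have hre' : 0 < w.re := lt_of_le_of_lt (by positivity) hy
  have hw : w ≠ 0 := fun h => by simp [h] at hre'
  have harg : w.arg = Real.arctan (w.im / w.re) := by
    rw [← Complex.tan_arg, Real.arctan_tan]
    · exact (abs_lt.1 (Complex.abs_arg_lt_pi_div_two_iff.2 (Or.inl hre'))).1
    · exact (abs_lt.1 (Complex.abs_arg_lt_pi_div_two_iff.2 (Or.inl hre'))).2
  have h := norm_exp_le_of_quadratic_bounds hf hk hβ hβ1 h₁ h₂ (ζ := log w) ?_ ?_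
  · rwa [exp_log hw] at h
  · rw [log_im, harg]
    refine Real.arctan_strictMono.monotone ?_
    rw [le_div_iff₀ hre']; exact hx.le
  · rw [log_im, harg, ← Real.arctan_inv_of_pos hβ]
    refine Real.arctan_strictMono.monotone ?_
    rw [div_le_iff₀ hre', inv_mul_eq_div, le_div_iff₀ hβ, mul_comm]
    exact hy.le

/-- A Phragmén–Lindelöf principle at the critical order: Gaussian bounds with a gain `β²` along
the real and along the imaginary axis give a gain `β` in every direction. -/
theorem norm_le_of_quadratic_bounds {f : ℂ → ℂ} (hf : Differentiable ℂ f) {M k β : ℝ}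
    (hk : 0 ≤ k) (hβ : 0 < β) (hβ1 : β < 1)
    (h₁ : ∀ w, ‖f w‖ ≤ M * Real.exp (k * (β ^ 2 * w.re ^ 2 + w.im ^ 2)))
    (h₂ : ∀ w, ‖f w‖ ≤ M * Real.exp (k * (w.re ^ 2 + β ^ 2 * w.im ^ 2))) (w : ℂ) :
    ‖f w‖ ≤ M * Real.exp (k * β * ‖w‖ ^ 2) := by
  have half : ∀ {g : ℂ → ℂ}, Differentiable ℂ g →
      (∀ w, ‖g w‖ ≤ M * Real.exp (k * (β ^ 2 * w.re ^ 2 + w.im ^ 2))) →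
      (∀ w, ‖g w‖ ≤ M * Real.exp (k * (w.re ^ 2 + β ^ 2 * w.im ^ 2))) →
      ∀ w : ℂ, 0 ≤ w.im → ‖g w‖ ≤ M * Real.exp (k * β * ‖w‖ ^ 2) := by
    intro g hg g₁ g₂ w him
    rcases le_total 0 w.re with hre | hre
    · exact norm_le_of_quadratic_bounds_quadrant hg hk hβ hβ1 g₁ g₂ hre him
    -- A quarter turn carries the second quadrant to the first and exchanges the two hypotheses.
    · have h := norm_le_of_quadratic_bounds_quadrant (f := fun v => g (Complex.I * v))
        (hg.comp (by fun_prop)) (M := M) hk hβ hβ1 (fun v => ?_) (fun v => ?_)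
        (w := -Complex.I * w) (by simpa using him) (by simpa using hre)
      · have e : Complex.I * (-Complex.I * w) = w := by
          linear_combination -w * Complex.I_sq
        simp only [e] at h
        simpa using h
      · simpa [add_comm] using g₂ (Complex.I * v)
      · simpa [add_comm] using g₁ (Complex.I * v)
  rcases le_total 0 w.im with him | him
  · exact half hf h₁ h₂ w him
  · have h := half (g := fun v => f (-v)) (hf.comp (by fun_prop)) (fun v => by simpa using h₁ (-v))
      (fun v => by simpa using h₂ (-v)) (-w) (by simpa using him)
    simpa using h

end PhragmenLindelof

/-! ### From Bargmann bounds back to pointwise decay. -/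

section Inversion

open scoped FourierTransform in
/-- Fourier inversion, almost everywhere, for integrable functions with integrable transform. -/
theorem MeasureTheory.Integrable.fourierInv_fourier_ae_eq {V : Type*} [NormedAddCommGroup V]
    [InnerProductSpace ℝ V] [FiniteDimensional ℝ V] [MeasurableSpace V] [BorelSpace V]
    {f : V → ℂ} (hf : Integrable f) (hf' : Integrable (𝓕 f)) : ∀ᵐ x, 𝓕⁻ (𝓕 f) x = f x := by
  have hcont : Continuous (𝓕⁻ (𝓕 f)) := by
    rw [Real.fourierInv_eq_fourier_comp_neg]
    exact VectorFourier.fourierIntegral_continuous Real.continuous_fourierChar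
      (L := innerₗ V) continuous_inner hf'.comp_neg
  -- As f need not be continuous, the identity is tested against smooth compactly supported
  -- functions; the multiplication formula, used twice, moves both transforms onto the test
  -- function.
  refine ae_eq_of_integral_contDiff_smul_eq hcont.locallyIntegrable hf.locallyIntegrable ?_
  intro g hg hgc
  have hgc' : HasCompactSupport fun x => (g x : ℂ) := hgc.comp_left Complex.ofReal_zero
  set φ : 𝓢(V, ℂ) := hgc'.toSchwartzMap (Complex.ofRealCLM.contDiff.comp hg) with hφ
  have hφx : ∀ x, φ x = (g x : ℂ) := fun x => rfl
  have flip : ∀ (ψ : 𝓢(V, ℂ)) {h : V → ℂ}, Integrable h →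
      ∫ ξ, (𝓕 (ψ : V → ℂ)) ξ * h ξ = ∫ x, ψ x * 𝓕 h x := fun ψ h hh => by
    simpa using! VectorFourier.integral_fourierIntegral_smul_eq_flip (L := innerₗ V)
      Real.continuous_fourierChar continuous_inner ψ.integrable hh
  have h1 : (𝓕 ((𝓕⁻ φ : 𝓢(V, ℂ)) : V → ℂ)) = φ := by
    rw [← SchwartzMap.fourier_coe, FourierTransform.fourier_fourierInv_eq]
  have h2 : ∀ x, (𝓕⁻ φ : 𝓢(V, ℂ)) (-x) = 𝓕 (φ : V → ℂ) x := fun x => by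
    rw [SchwartzMap.fourierInv_coe, Real.fourierInv_eq_fourier_neg, neg_neg]
  calc ∫ x, g x • 𝓕⁻ (𝓕 f) x = ∫ x, φ x * 𝓕 (fun y => 𝓕 f (-y)) x := by
        refine integral_congr_ae (Filter.Eventually.of_forall fun x => ?_)
        simp only [hφx, Complex.real_smul]
        rw [Real.fourierInv_eq_fourier_comp_neg]
    _ = ∫ x, 𝓕 (φ : V → ℂ) x * 𝓕 f (-x) := (flip φ hf'.comp_neg).symm
    _ = ∫ x, (𝓕⁻ φ : 𝓢(V, ℂ)) x * 𝓕 f x := by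
        rw [← integral_neg_eq_self]
        refine integral_congr_ae (Filter.Eventually.of_forall fun x => ?_)
        simp only [neg_neg]
        rw [← h2, neg_neg]
    _ = ∫ x, φ x * f x := by rw [← flip _ hf, h1]
    _ = ∫ x, g x • f x := by simp only [hφx, Complex.real_smul]

variable {d : ℕ}

theorem reVec_ofReal_sub (s y : EuclideanSpace ℝ (Fin d)) (r : ℝ) :
    reVec (fun j => (s j : ℂ) - (r : ℂ) * Complex.I * (y j : ℂ)) = s := by
  ext j; simp [reVec]

theorem imVec_ofReal_sub (s y : EuclideanSpace ℝ (Fin d)) (r : ℝ) :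
    imVec (fun j => (s j : ℂ) - (r : ℂ) * Complex.I * (y j : ℂ)) = -r • y := by
  ext j; simp [imVec]

/-- On a slice with fixed real part the kernel is a plane wave times a real weight times a factor
free of x, so there the Bargmann transform is a Fourier transform. -/
theorem coherent_ofReal_sub (s y x : EuclideanSpace ℝ (Fin d)) (r : ℝ) :
    coherent (fun j => (s j : ℂ) - (r : ℂ) * Complex.I * (y j : ℂ)) x =
      Complex.exp (-(r * inner ℝ x y : ℝ) * Complex.I) *
        (Real.exp (inner ℝ s x - ‖x‖ ^ 2 / 2) : ℝ) *
        Complex.exp (-(∑ j, ((s j : ℂ) - (r : ℂ) * Complex.I * (y j : ℂ)) ^ 2) / 4) := by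
  have h : cdot (fun j => (s j : ℂ) - (r : ℂ) * Complex.I * (y j : ℂ)) x =
      ((inner ℝ s x : ℝ) : ℂ) - ((r * inner ℝ x y : ℝ) : ℂ) * Complex.I := by
    apply Complex.ext
    · rw [cdot_re, reVec_ofReal_sub]; simp
    · rw [cdot_im, imVec_ofReal_sub, inner_smul_left, real_inner_comm]; simp
  rw [coherent, h, Complex.ofReal_exp, ← Complex.exp_add, ← Complex.exp_add]
  congr 1
  push_cast
  ring

open scoped FourierTransform in
/-- A bound on a vertical slice of the Bargmann transform gives an exponential bound. -/
theorem norm_le_of_bargmann_slice {v : EuclideanSpace ℝ (Fin d) → ℂ} {M b κ : ℝ} (hκ : κ < 1)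
    (hv : ∀ z, Integrable fun x => v x * coherent z x)
    (h : ∀ z, ‖bargmann v z‖ ≤
      M * Real.exp ((b * ‖reVec z‖ ^ 2 + κ * ‖imVec z‖ ^ 2) / 4))
    (s : EuclideanSpace ℝ (Fin d)) :
    ∀ᵐ x, ‖v x‖ ≤ (Real.pi * (1 - κ)) ^ (-((d : ℝ) / 2)) * M *
      Real.exp ((1 + b) * ‖s‖ ^ 2 / 4 - inner ℝ s x + ‖x‖ ^ 2 / 2) := by
  have hκ' : 0 < 1 - κ := by linarith
  set g : EuclideanSpace ℝ (Fin d) → ℂ :=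
    fun x => v x * (Real.exp (inner ℝ s x - ‖x‖ ^ 2 / 2) : ℝ) with hg_def
  set Z : EuclideanSpace ℝ (Fin d) → Fin d → ℂ :=
    fun y j => (s j : ℂ) - ((2 * Real.pi : ℝ) : ℂ) * Complex.I * (y j : ℂ) with hZ
  have hcoh : ∀ y x, v x * coherent (Z y) x *
      Complex.exp ((∑ j, Z y j ^ 2) / 4) =
      Complex.exp (-(2 * Real.pi * inner ℝ x y : ℝ) * Complex.I) * g x := fun y x => by
    rw [hZ, coherent_ofReal_sub, mul_assoc, mul_assoc _ (Complex.exp (-_ / 4)), ← Complex.exp_add,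
      neg_div, neg_add_cancel, Complex.exp_zero, hg_def]
    ring
  have hg : Integrable g := by
    refine ((hv (Z 0)).mul_const (Complex.exp ((∑ j, Z 0 j ^ 2) / 4))).congr
      (Filter.Eventually.of_forall fun x => ?_)
    simp only [hcoh]
    simp
  have hF : ∀ y, 𝓕 g y = bargmann v (Z y) * Complex.exp ((∑ j, Z y j ^ 2) / 4) := fun y => by
    rw [bargmann, ← integral_mul_const, Real.fourier_eq']
    refine integral_congr_ae (Filter.Eventually.of_forall fun x => ?_)
    simp only [hcoh, smul_eq_mul]
    congr 3
    push_cast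
    ring
  have hre : ∀ y, reVec (Z y) = s := fun y => reVec_ofReal_sub s y _
  have him : ∀ y, ‖imVec (Z y)‖ ^ 2 = 4 * Real.pi ^ 2 * ‖y‖ ^ 2 := fun y => by
    rw [hZ, imVec_ofReal_sub, norm_smul, mul_pow, Real.norm_eq_abs, sq_abs]
    ring
  -- The hypothesis grows like exp(κπ²|y|²) and the prefactor decays like exp(-π²|y|²); κ < 1 leaves
  -- an integrable Gaussian.
  have hle : ∀ y, ‖𝓕 g y‖ ≤ M * Real.exp ((1 + b) * ‖s‖ ^ 2 / 4) *
      Real.exp (-((1 - κ) * Real.pi ^ 2) * ‖y‖ ^ 2) := fun y => by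
    have h1 : ((∑ j, Z y j ^ 2) / 4).re = (‖s‖ ^ 2 - 4 * Real.pi ^ 2 * ‖y‖ ^ 2) / 4 := by
      rw [show ((∑ j, Z y j ^ 2) / 4) = (∑ j, Z y j ^ 2) / ((4 : ℝ) : ℂ) by push_cast; ring,
        Complex.div_ofReal_re, sum_sq_re, hre, him]
    rw [hF, norm_mul, Complex.norm_exp, h1]
    refine (mul_le_mul_of_nonneg_right (h _) (Real.exp_pos _).le).trans (le_of_eq ?_)
    rw [hre, him, mul_assoc, mul_assoc M, ← Real.exp_add, ← Real.exp_add]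
    congr 2
    ring
  have hb : 0 < (1 - κ) * Real.pi ^ 2 := by positivity
  have hdom := (integrable_exp_neg_mul_norm_sq (d := d) hb).const_mul
    (M * Real.exp ((1 + b) * ‖s‖ ^ 2 / 4))
  have hFcont : Continuous (𝓕 g) :=
    VectorFourier.fourierIntegral_continuous Real.continuous_fourierChar
      (L := innerₗ (EuclideanSpace ℝ (Fin d))) continuous_inner hg
  have hFint : Integrable (𝓕 g) :=
    hdom.mono' hFcont.aestronglyMeasurable (Filter.Eventually.of_forall hle)
  filter_upwards [hg.fourierInv_fourier_ae_eq hFint] with x hx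
  have h2 : ‖g x‖ ≤ M * Real.exp ((1 + b) * ‖s‖ ^ 2 / 4) *
      (Real.pi * (1 - κ)) ^ (-((d : ℝ) / 2)) := by
    rw [← hx, Real.fourierInv_eq]
    refine (norm_integral_le_of_norm_le hdom (Filter.Eventually.of_forall fun y => ?_)).trans
      (le_of_eq ?_)
    · rw [Circle.norm_smul]; exact hle y
    · rw [integral_const_mul, GaussianFourier.integral_rexp_neg_mul_sq_norm hb,
        finrank_euclideanSpace_fin, Real.rpow_neg (by positivity),
        ← Real.inv_rpow (by positivity)]
      congr 2
      field_simp
  have h3 : ‖v x‖ = ‖g x‖ * Real.exp (‖x‖ ^ 2 / 2 - inner ℝ s x) := by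
    rw [hg_def, norm_mul, Complex.norm_real, Real.norm_of_nonneg (Real.exp_pos _).le, mul_assoc,
      ← Real.exp_add]
    simp
  rw [h3]
  refine (mul_le_mul_of_nonneg_right h2 (Real.exp_pos _).le).trans (le_of_eq ?_)
  rw [show (1 + b) * ‖s‖ ^ 2 / 4 - inner ℝ s x + ‖x‖ ^ 2 / 2 =
    (1 + b) * ‖s‖ ^ 2 / 4 + (‖x‖ ^ 2 / 2 - inner ℝ s x) by ring, Real.exp_add]
  ring

/-- A Gaussian bound on the Bargmann transform gives a Gaussian bound on the function. -/
theorem norm_le_of_bargmann_bound {v : EuclideanSpace ℝ (Fin d) → ℂ} {M b κ : ℝ} (hb : 0 ≤ b)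
    (hκ : κ < 1) (hv : ∀ z, Integrable fun x => v x * coherent z x)
    (h : ∀ z, ‖bargmann v z‖ ≤
      M * Real.exp ((b * ‖reVec z‖ ^ 2 + κ * ‖imVec z‖ ^ 2) / 4)) :
    ∀ᵐ x, ‖v x‖ ≤ (Real.pi * (1 - κ)) ^ (-((d : ℝ) / 2)) * M *
      Real.exp (-((1 - b) / (1 + b) * ‖x‖ ^ 2 / 2)) := by
  -- The exceptional null set depends on s, so s first runs over a countable dense set; continuity
  -- in s then gives all s for almost every x.
  obtain ⟨D, hDc, hDd⟩ := TopologicalSpace.exists_countable_dense (EuclideanSpace ℝ (Fin d))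
  have hall : ∀ᵐ x, ∀ s ∈ D, ‖v x‖ ≤ (Real.pi * (1 - κ)) ^ (-((d : ℝ) / 2)) * M *
      Real.exp ((1 + b) * ‖s‖ ^ 2 / 4 - inner ℝ s x + ‖x‖ ^ 2 / 2) :=
    (ae_ball_iff hDc).2 fun s _ => norm_le_of_bargmann_slice hκ hv h s
  filter_upwards [hall] with x hx
  have hcl : IsClosed {s : EuclideanSpace ℝ (Fin d) | ‖v x‖ ≤
      (Real.pi * (1 - κ)) ^ (-((d : ℝ) / 2)) * M *
      Real.exp ((1 + b) * ‖s‖ ^ 2 / 4 - inner ℝ s x + ‖x‖ ^ 2 / 2)} :=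
    isClosed_le continuous_const (by fun_prop)
  -- s = 2x/(1+b) minimizes the exponent.
  have hmem := hcl.closure_subset_iff.2 hx (hDd ((2 / (1 + b)) • x))
  simp only [Set.mem_ofPred_eq, norm_smul, inner_smul_left, real_inner_self_eq_norm_sq] at hmem
  refine hmem.trans (le_of_eq ?_)
  have hb1 : 0 < 1 + b := by linarith
  rw [Real.norm_of_nonneg (by positivity)]
  congr 2
  simp only [conj_trivial]
  field_simp
  ring

end Inversion

/-! ### The Bargmann kernel as a test function. -/

section Transport

variable {d : ℕ}

/-- `x ↦ z · x` as a real-linear map. -/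
noncomputable def cdotCLM (z : Fin d → ℂ) : EuclideanSpace ℝ (Fin d) →L[ℝ] ℂ :=
  ∑ j, z j • (Complex.ofRealCLM ∘L (EuclideanSpace.proj j : EuclideanSpace ℝ (Fin d) →L[ℝ] ℝ))

theorem cdotCLM_apply (z : Fin d → ℂ) (x : EuclideanSpace ℝ (Fin d)) :
    cdotCLM z x = cdot z x := by
  simp [cdotCLM, cdot]

/-- The exponent of the Bargmann kernel. -/
noncomputable def coherentExponent (z : Fin d → ℂ) (x : EuclideanSpace ℝ (Fin d)) : ℂ :=
  cdotCLM z x - ((‖x‖ ^ 2 : ℝ) : ℂ) / 2 - (∑ j, z j ^ 2) / 4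

theorem coherent_eq_exp (z : Fin d → ℂ) :
    coherent z = Complex.exp ∘ coherentExponent z := by
  ext x
  simp [coherent, coherentExponent, cdotCLM_apply]

theorem hasTemperateGrowth_coherentExponent (z : Fin d → ℂ) :
    (coherentExponent z).HasTemperateGrowth := by
  have h2 : (fun x : EuclideanSpace ℝ (Fin d) =>
      ((‖x‖ ^ 2 : ℝ) : ℂ)).HasTemperateGrowth := by
    fun_prop
  unfold coherentExponent
  simp only [div_eq_mul_inv]
  fun_prop

theorem contDiff_coherent (z : Fin d → ℂ) : ContDiff ℝ (⊤ : ℕ∞) (coherent z) := by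
  rw [coherent_eq_exp]
  exact Complex.contDiff_exp.comp (hasTemperateGrowth_coherentExponent z).1

theorem one_add_pow_mul_exp_le (N : ℕ) {r : ℝ} (hr : 0 ≤ r) :
    (1 + r) ^ N * Real.exp (-(1 / 4) * r ^ 2) ≤ N.factorial * Real.exp 2 := by
  have h1 : (1 + r) ^ N ≤ N.factorial * Real.exp (1 + r) := by
    have := Real.pow_div_factorial_le_exp (1 + r) (by linarith) N
    rwa [div_le_iff₀' (by positivity)] at this
  refine (mul_le_mul_of_nonneg_right h1 (Real.exp_pos _).le).trans ?_
  rw [mul_assoc, ← Real.exp_add]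
  refine mul_le_mul_of_nonneg_left (Real.exp_le_exp.2 ?_) (by positivity)
  nlinarith [sq_nonneg (r / 2 - 1)]

/-- Derivatives of the exponent grow polynomially, so those of the kernel are at most a polynomial
times its Gaussian modulus. -/
theorem coherent_decay (z : Fin d → ℂ) (m n : ℕ) :
    ∃ C : ℝ, ∀ x, ‖x‖ ^ m * ‖iteratedFDeriv ℝ n (coherent z) x‖ ≤ C := by
  obtain ⟨k, C₁, hC₁, h₁⟩ :=
    (hasTemperateGrowth_coherentExponent z).norm_iteratedFDeriv_le_uniform n
  set C₀ : ℝ := ∑ i ∈ Finset.range (n + 1), ‖iteratedFDeriv ℝ i Complex.exp 0‖ with hC₀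
  have hC₀n : 0 ≤ C₀ := Finset.sum_nonneg fun i _ => norm_nonneg _
  set G := Real.exp (2 * (∑ j, ‖z j‖) ^ 2) with hG
  refine ⟨n.factorial * C₀ * (1 + C₁) ^ n * G *
    ((m + k * n).factorial * Real.exp 2), fun x => ?_⟩
  set q := coherentExponent z with hq
  have hsm := (hasTemperateGrowth_coherentExponent z).1
  -- Subtracting the value at x makes the exponent vanish there, so only the derivatives of exp at 0
  -- enter the chain-rule bound.
  have hsplit : coherent z = Complex.exp (q x) • (Complex.exp ∘ fun y => q y - q x) := by
    ext y
    simp [coherent_eq_exp, ← Complex.exp_add, hq]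
  have hsm' : ContDiff ℝ (⊤ : ℕ∞) fun y => q y - q x := hsm.sub contDiff_const
  have hx1 : 1 ≤ 1 + ‖x‖ := by linarith [norm_nonneg x]
  have hD1 : 1 ≤ (1 + C₁) * (1 + ‖x‖) ^ k :=
    one_le_mul_of_one_le_of_one_le (by linarith) (one_le_pow₀ hx1)
  have hcomp : ‖iteratedFDeriv ℝ n (Complex.exp ∘ fun y => q y - q x) x‖ ≤
      n.factorial * C₀ * ((1 + C₁) * (1 + ‖x‖) ^ k) ^ n := by
    refine norm_iteratedFDeriv_comp_le (N := (⊤ : ℕ∞)) Complex.contDiff_exp hsm'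
      (mod_cast le_top) x ?_ ?_
    · intro i hi
      rw [sub_self]
      exact Finset.single_le_sum (f := fun i => ‖iteratedFDeriv ℝ i Complex.exp (0 : ℂ)‖)
        (fun i _ => norm_nonneg _) (Finset.mem_range.2 (Nat.lt_succ_of_le hi))
    · intro i hi hin
      have e : iteratedFDeriv ℝ i (fun y => q y - q x) x = iteratedFDeriv ℝ i q x := by
        have h2 : (fun y => q y - q x) = q - fun _ => q x := rfl
        rw [h2, iteratedFDeriv_sub_apply (hsm.contDiffAt.of_le (mod_cast le_top))
          contDiffAt_const, iteratedFDeriv_const_of_ne (by omega)]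
        simp [hq]
      rw [e]
      refine (h₁ i hin x).trans ?_
      -- The chain-rule estimate asks for D^i with i ≥ 1, and D ≥ 1.
      refine le_trans ?_ (le_self_pow₀ hD1 (by omega))
      exact mul_le_mul_of_nonneg_right (by linarith) (by positivity)
  have hφ : ‖Complex.exp (q x)‖ ≤ G * Real.exp (-(1 / 4) * ‖x‖ ^ 2) := by
    have := norm_coherent_le_gaussian z le_rfl x
    rwa [coherent_eq_exp] at this
  rw [hsplit, iteratedFDeriv_const_smul_apply
    ((Complex.contDiff_exp.comp hsm').contDiffAt.of_le (mod_cast le_top)), norm_smul]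
  calc ‖x‖ ^ m * (‖Complex.exp (q x)‖ *
        ‖iteratedFDeriv ℝ n (Complex.exp ∘ fun y => q y - q x) x‖)
      ≤ (1 + ‖x‖) ^ m * (G * Real.exp (-(1 / 4) * ‖x‖ ^ 2) *
          (n.factorial * C₀ * ((1 + C₁) * (1 + ‖x‖) ^ k) ^ n)) := by
        gcongr
        linarith
    _ = n.factorial * C₀ * (1 + C₁) ^ n * G *
          ((1 + ‖x‖) ^ (m + k * n) * Real.exp (-(1 / 4) * ‖x‖ ^ 2)) := by
        rw [mul_pow, pow_add, pow_mul]; ring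
    _ ≤ _ := mul_le_mul_of_nonneg_left (one_add_pow_mul_exp_le _ (norm_nonneg x)) (by positivity)

/-- The Bargmann kernel as a Schwartz function. -/
noncomputable def coherentSchwartz (z : Fin d → ℂ) : 𝓢(EuclideanSpace ℝ (Fin d), ℂ) where
  toFun := coherent z
  smooth' := contDiff_coherent z
  decay' := coherent_decay z

theorem coe_coherentSchwartz (z : Fin d → ℂ) : ⇑(coherentSchwartz z) = coherent z := rfl

theorem hasFDerivAt_coherent (z : Fin d → ℂ) (x : EuclideanSpace ℝ (Fin d)) :
    HasFDerivAt (coherent z)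
      (coherent z x • (cdotCLM z - Complex.ofRealCLM ∘L innerSL ℝ x)) x := by
  have h2 : HasFDerivAt (fun y : EuclideanSpace ℝ (Fin d) => ((‖y‖ : ℂ)) ^ 2 / 2)
      (Complex.ofRealCLM ∘L innerSL ℝ x) x := by
    have h3 := (Complex.ofRealCLM.hasFDerivAt.comp x
      (hasStrictFDerivAt_norm_sq x).hasFDerivAt).const_mul (1 / 2 : ℂ)
    refine (h3.congr_fderiv ?_).congr_of_eventuallyEq (Filter.Eventually.of_forall fun y => ?_)
    · ext v
      simp
    · simp; ring
  have h1 : HasFDerivAt (cdot z) (cdotCLM z) x :=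
    (cdotCLM z).hasFDerivAt.congr_of_eventuallyEq
      (Filter.Eventually.of_forall fun y => (cdotCLM_apply z y).symm)
  exact ((h1.sub h2).sub_const _).cexp

/-- The Laplacian of the Bargmann kernel. -/
theorem laplacian_coherent (z : Fin d → ℂ) (x : EuclideanSpace ℝ (Fin d)) :
    Δ (coherent z) x = coherent z x *
      (∑ j, z j ^ 2 - 2 * cdot z x + ((‖x‖ ^ 2 : ℝ) : ℂ) - d) := by
  have hsm := contDiff_coherent z
  have key : ∀ v : EuclideanSpace ℝ (Fin d),
      iteratedFDeriv ℝ 2 (coherent z) x ![v, v] =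
        coherent z x * ((cdot z v - (inner ℝ x v : ℝ)) ^ 2 - ((inner ℝ v v : ℝ) : ℂ)) := by
    intro v
    rw [iteratedFDeriv_two_apply]
    simp only [Matrix.cons_val_zero, Matrix.cons_val_one]
    have hd : DifferentiableAt ℝ (fderiv ℝ (coherent z)) x :=
      (hsm.fderiv_right (m := 1) (by norm_cast)).differentiable (by simp) x
    have e1 : fderiv ℝ (fun y => fderiv ℝ (coherent z) y v) x v =
        fderiv ℝ (fderiv ℝ (coherent z)) x v v := by
      rw [fderiv_clm_apply hd (differentiableAt_const v)]
      simp
    have e2 : (fun y => fderiv ℝ (coherent z) y v) =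
        fun y => coherent z y * (cdot z v - ((inner ℝ v y : ℝ) : ℂ)) := by
      ext y
      rw [(hasFDerivAt_coherent z y).fderiv]
      simp [cdotCLM_apply, real_inner_comm]
    have e3 : HasFDerivAt (fun y => cdot z v - ((inner ℝ v y : ℝ) : ℂ))
        (-(Complex.ofRealCLM ∘L innerSL ℝ v)) x :=
      (Complex.ofRealCLM ∘L innerSL ℝ v).hasFDerivAt.const_sub _
    rw [← e1, e2, ((hasFDerivAt_coherent z x).fun_mul e3).fderiv]
    simp [cdotCLM_apply, real_inner_comm]
    ring
  rw [InnerProductSpace.laplacian_eq_iteratedFDeriv_orthonormalBasis _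
    (EuclideanSpace.basisFun (Fin d) ℝ)]
  simp only [key, EuclideanSpace.basisFun_apply]
  have h1 : ((‖x‖ ^ 2 : ℝ) : ℂ) = ∑ j, (x j : ℂ) ^ 2 := by
    have := EuclideanSpace.norm_sq_eq x
    simp only [Real.norm_eq_abs, sq_abs] at this
    exact_mod_cast this
  have h2 : ∀ j, cdot z (EuclideanSpace.single j (1 : ℝ)) = z j := fun j => by
    rw [cdot, Finset.sum_eq_single j] <;> simp +contextual
  rw [← Finset.mul_sum, Finset.sum_sub_distrib]
  congr 2
  · rw [h1, cdot, Finset.mul_sum, ← Finset.sum_sub_distrib, ← Finset.sum_add_distrib]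
    refine Finset.sum_congr rfl fun j _ => ?_
    rw [h2]
    simp [EuclideanSpace.inner_single_right]
    ring
  · simp

/-- Cauchy–Schwarz, phrased with the `Lp` norm in which the solution is continuous in time. -/
theorem integral_norm_mul_norm_le {α : Type*} [MeasurableSpace α] {μ : Measure α} {f g : α → ℂ}
    (hf : MemLp f 2 μ) (hg : MemLp g 2 μ) :
    ∫ x, ‖f x‖ * ‖g x‖ ∂μ ≤ ‖hf.toLp f‖ * ‖hg.toLp g‖ := by
  have h2 : ENNReal.ofReal 2 = 2 := by simp
  have h := integral_mul_norm_le_Lp_mul_Lq (μ := μ) (f := f) (g := g)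
    Real.HolderConjugate.two_two (by rwa [h2]) (by rwa [h2])
  have e : ∀ {h : α → ℂ} (hh : MemLp h 2 μ), ‖hh.toLp h‖ = (∫ x, ‖h x‖ ^ (2 : ℝ) ∂μ) ^ (1 / (2 : ℝ)) := by
    intro h hh
    rw [Lp.norm_toLp, hh.eLpNorm_eq_integral_rpow_norm (by norm_num) (by norm_num),
      ENNReal.toReal_ofReal (by positivity)]
    simp
  rw [e hf, e hg]
  exact h

theorem memLp_two_exp_neg_mul_norm_sq {b : ℝ} (hb : 0 < b) (K : ℝ) :
    MemLp (fun x : EuclideanSpace ℝ (Fin d) => ((K * Real.exp (-b * ‖x‖ ^ 2) : ℝ) : ℂ)) 2 := by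
  rw [memLp_two_iff_integrable_sq_norm (Continuous.aestronglyMeasurable (by fun_prop))]
  refine ((integrable_exp_neg_mul_norm_sq (d := d) (b := 2 * b) (by positivity)).const_mul
    (K ^ 2)).congr (Filter.Eventually.of_forall fun x => ?_)
  simp only [Complex.norm_real, Real.norm_eq_abs, sq_abs]
  rw [mul_pow, ← Real.exp_nat_mul]
  ring_nf

theorem memLp_two_coherent (z : Fin d → ℂ) : MemLp (coherent z) 2 :=
  (memLp_two_exp_neg_mul_norm_sq (d := d) (b := 1 / 4) (by norm_num)
    (Real.exp (2 * (∑ j, ‖z j‖) ^ 2))).mono (continuous_coherent z).aestronglyMeasurable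
    (Filter.Eventually.of_forall fun x => by
      rw [Complex.norm_real, Real.norm_of_nonneg (by positivity)]
      exact norm_coherent_le_gaussian z le_rfl x)

theorem MeasureTheory.MemLp.integrable_mul_coherent {f : EuclideanSpace ℝ (Fin d) → ℂ}
    (hf : MemLp f 2) (z : Fin d → ℂ) : Integrable fun x => f x * coherent z x :=
  hf.integrable_mul (memLp_two_coherent z)

end Transport

/-! ### The flow rotates the Bargmann transform. -/

section Evolution

variable {d : ℕ}

/-- Rotation of a complex vector by the angle `-2s`. -/
noncomputable def rotated (z : Fin d → ℂ) (s : ℝ) : Fin d → ℂ :=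
  fun j => Complex.exp (-2 * Complex.I * s) * z j

theorem norm_exp_mul_I_ofReal (s : ℝ) : ‖Complex.exp (-2 * Complex.I * s)‖ = 1 := by
  rw [show -2 * Complex.I * (s : ℂ) = ((-2 * s : ℝ) : ℂ) * Complex.I by push_cast; ring]
  exact Complex.norm_exp_ofReal_mul_I _

theorem sum_norm_rotated (z : Fin d → ℂ) (s : ℝ) : ∑ j, ‖rotated z s j‖ = ∑ j, ‖z j‖ := by
  simp only [rotated, norm_mul, norm_exp_mul_I_ofReal, one_mul]

/-- The derivative of the Bargmann kernel along the rotation. -/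
noncomputable def coherentDeriv (z : Fin d → ℂ) (x : EuclideanSpace ℝ (Fin d)) : ℂ :=
  coherent z x * (-Complex.I * (2 * cdot z x - ∑ j, z j ^ 2))

theorem cdot_mul (w : ℂ) (z : Fin d → ℂ) (x : EuclideanSpace ℝ (Fin d)) :
    cdot (fun j => w * z j) x = w * cdot z x := by
  simp [cdot, Finset.mul_sum, mul_assoc]

theorem sum_mul_sq (w : ℂ) (z : Fin d → ℂ) : ∑ j, (w * z j) ^ 2 = w ^ 2 * ∑ j, z j ^ 2 := by
  simp [Finset.mul_sum, mul_pow]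

theorem hasDerivAt_coherent_rotated (z : Fin d → ℂ) (x : EuclideanSpace ℝ (Fin d)) (s : ℝ) :
    HasDerivAt (fun s => coherent (rotated z s) x) (coherentDeriv (rotated z s) x) s := by
  have hw : HasDerivAt (fun s : ℝ => Complex.exp (-2 * Complex.I * s))
      (Complex.exp (-2 * Complex.I * s) * (-2 * Complex.I * 1)) s :=
    ((Complex.ofRealCLM.hasDerivAt (x := s)).const_mul (-2 * Complex.I)).cexp
  have h := (((hw.mul_const (cdot z x)).sub_const ((‖x‖ : ℂ) ^ 2 / 2)).fun_sub
    (((hw.fun_pow 2).mul_const (∑ j, z j ^ 2)).div_const 4)).cexp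
  have e₁ : ∀ r, cdot (rotated z r) x = Complex.exp (-2 * Complex.I * r) * cdot z x :=
    fun r => cdot_mul _ _ _
  have e₂ : ∀ r, ∑ j, rotated z r j ^ 2 =
      Complex.exp (-2 * Complex.I * r) ^ 2 * ∑ j, z j ^ 2 := fun r => sum_mul_sq _ _
  simp only [coherentDeriv, coherent, e₁, e₂]
  refine h.congr_deriv ?_
  simp only [Nat.add_one_sub_one, pow_one, Nat.cast_ofNat]
  ring

/-- Half of the Gaussian decay is spent on absorbing the factor linear in x. The remainder is a
square-integrable Lipschitz majorant, uniform over the rotation angle. -/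
theorem norm_coherentDeriv_le {S : ℝ} (z : Fin d → ℂ) (hS : ∑ j, ‖z j‖ ≤ S)
    (x : EuclideanSpace ℝ (Fin d)) :
    ‖coherentDeriv z x‖ ≤ Real.exp (2 * S ^ 2) * (9 * S ^ 2 + 1) *
      Real.exp (-(1 / 8) * ‖x‖ ^ 2) := by
  have hS0 : 0 ≤ S := (Finset.sum_nonneg fun j _ => norm_nonneg _).trans hS
  have h0 : 0 ≤ ∑ j, ‖z j‖ := Finset.sum_nonneg fun j _ => norm_nonneg _
  have h1 : ‖-Complex.I * (2 * cdot z x - ∑ j, z j ^ 2)‖ ≤ 2 * S * ‖x‖ + S ^ 2 := by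
    rw [norm_mul, norm_neg, Complex.norm_I, one_mul]
    refine (norm_sub_le _ _).trans (add_le_add ?_ ?_)
    · rw [norm_mul, Complex.norm_ofNat, mul_assoc]
      exact mul_le_mul_of_nonneg_left ((norm_cdot_le z x).trans
        (mul_le_mul_of_nonneg_right hS (norm_nonneg _))) (by norm_num)
    · simp only [pow_two]
      exact (norm_sum_mul_le z z).trans (mul_le_mul hS hS h0 hS0)
  have h2 : 2 * S * ‖x‖ + S ^ 2 ≤ (9 * S ^ 2 + 1) * Real.exp (1 / 8 * ‖x‖ ^ 2) := by
    have h3 := Real.add_one_le_exp (1 / 8 * ‖x‖ ^ 2)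
    have h4 : (9 * S ^ 2 + 1) * (1 / 8 * ‖x‖ ^ 2 + 1) ≤
        (9 * S ^ 2 + 1) * Real.exp (1 / 8 * ‖x‖ ^ 2) :=
      mul_le_mul_of_nonneg_left h3 (by positivity)
    nlinarith [sq_nonneg (8 * S - ‖x‖), mul_nonneg (sq_nonneg S) (sq_nonneg ‖x‖)]
  rw [coherentDeriv, norm_mul]
  calc ‖coherent z x‖ * ‖-Complex.I * (2 * cdot z x - ∑ j, z j ^ 2)‖
      ≤ (Real.exp (2 * S ^ 2) * Real.exp (-(1 / 4) * ‖x‖ ^ 2)) *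
        ((9 * S ^ 2 + 1) * Real.exp (1 / 8 * ‖x‖ ^ 2)) :=
        mul_le_mul (norm_coherent_le_gaussian z hS x) (h1.trans h2) (norm_nonneg _) (by positivity)
    _ = Real.exp (2 * S ^ 2) * (9 * S ^ 2 + 1) *
        (Real.exp (-(1 / 4) * ‖x‖ ^ 2) * Real.exp (1 / 8 * ‖x‖ ^ 2)) := by ring
    _ = _ := by rw [← Real.exp_add]; ring_nf

theorem continuous_coherentDeriv (z : Fin d → ℂ) : Continuous (coherentDeriv z) := by
  unfold coherentDeriv; fun_prop

variable {u₀ : EuclideanSpace ℝ (Fin d) → ℂ} {u : ℝ → EuclideanSpace ℝ (Fin d) → ℂ}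

theorem IsHarmonicSchrodingerSolution.hasDerivAt_coherent
    (hu : IsHarmonicSchrodingerSolution u₀ u) (z : Fin d → ℂ) (t : ℝ) :
    HasDerivAt (fun s => ∫ x, u s x * coherent z x)
      (Complex.I * ∫ x, u t x * (coherent z x * (d - ∑ j, z j ^ 2 + 2 * cdot z x))) t := by
  have h := hu.weak_eq (coherentSchwartz z) t
  simp only [coe_coherentSchwartz, laplacian_coherent] at h
  convert h using 4 with x
  ring

/-- The harmonic oscillator multiplies the kernel by d - z·z + 2z·x. Rotation at speed -2
contributes -i(2z·x - z·z), which cancels all but the ground-state term i·d. The weak equation only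
allows fixed test functions, so the product rule is proved by hand: the product of increments is
o(|r - s|), by L² continuity of u and the Lipschitz bound on the kernel. -/
theorem IsHarmonicSchrodingerSolution.hasDerivAt_rotated
    (hu : IsHarmonicSchrodingerSolution u₀ u) (z : Fin d → ℂ) (s : ℝ) :
    HasDerivAt (fun r => ∫ x, u r x * coherent (rotated z r) x)
      (Complex.I * d * ∫ x, u s x * coherent (rotated z s) x) s := by
  set S := ∑ j, ‖z j‖ with hS
  set K := Real.exp (2 * S ^ 2) * (9 * S ^ 2 + 1) with hK
  set D : EuclideanSpace ℝ (Fin d) → ℂ :=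
    fun x => ((K * Real.exp (-(1 / 8) * ‖x‖ ^ 2) : ℝ) : ℂ) with hD
  have hK0 : 0 ≤ K := by positivity
  have hDmem : MemLp D 2 := memLp_two_exp_neg_mul_norm_sq (by norm_num) K
  have hDn : ∀ x, ‖D x‖ = K * Real.exp (-(1 / 8) * ‖x‖ ^ 2) := fun x => by
    rw [hD, Complex.norm_real, Real.norm_of_nonneg (by positivity)]
  have hder : ∀ r x, ‖coherentDeriv (rotated z r) x‖ ≤ ‖D x‖ := fun r x => by
    rw [hDn]; exact norm_coherentDeriv_le _ (sum_norm_rotated z r).le x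
  have hlip : ∀ r x, ‖coherent (rotated z r) x - coherent (rotated z s) x‖ ≤
      ‖D x‖ * ‖r - s‖ := fun r x =>
    convex_univ.norm_image_sub_le_of_norm_hasDerivWithin_le (f := fun r => coherent (rotated z r) x)
      (fun r _ => (hasDerivAt_coherent_rotated z x r).hasDerivWithinAt) (fun r _ => hder r x)
      (Set.mem_univ s) (Set.mem_univ r)
  have hui : ∀ r r', Integrable fun x => u r x * coherent (rotated z r') x := fun r r' =>
    (hu.memLp_two r).integrable_mul_coherent _
  -- the mixed increment is negligible
  have h₁ : HasDerivAt (fun r => ∫ x, (u r x - u s x) *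
      (coherent (rotated z r) x - coherent (rotated z s) x)) 0 s := by
    have hle : ∀ r, ‖∫ x, (u r x - u s x) *
        (coherent (rotated z r) x - coherent (rotated z s) x)‖ ≤
        ‖(hu.memLp_two r).toLp (u r) - (hu.memLp_two s).toLp (u s)‖ *
          ‖hDmem.toLp D‖ * ‖r - s‖ := fun r => by
      have hm := (hu.memLp_two r).sub (hu.memLp_two s)
      have hi : Integrable fun x => ‖(u r - u s) x‖ * ‖D x‖ :=
        hm.norm.integrable_mul hDmem.norm
      refine (norm_integral_le_of_norm_le (hi.mul_const ‖r - s‖)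
        (Filter.Eventually.of_forall fun x => ?_)).trans ?_
      · rw [norm_mul, mul_assoc]
        exact mul_le_mul_of_nonneg_left (hlip r x) (norm_nonneg _)
      · rw [integral_mul_const, ← MemLp.toLp_sub]
        exact mul_le_mul_of_nonneg_right (integral_norm_mul_norm_le hm hDmem) (norm_nonneg _)
    have ht : Filter.Tendsto (fun r => ‖(hu.memLp_two r).toLp (u r) -
        (hu.memLp_two s).toLp (u s)‖ * ‖hDmem.toLp D‖) (nhds s) (nhds 0) := by
      have hc := ((hu.continuous_toLp.sub continuous_const).norm.mul
        (continuous_const (y := ‖hDmem.toLp D‖))).tendsto (x := s)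
        (f := fun r => ‖(hu.memLp_two r).toLp (u r) -
        (hu.memLp_two s).toLp (u s)‖ * ‖hDmem.toLp D‖)
      simpa using hc
    rw [hasDerivAt_iff_isLittleO]
    simp only [sub_self, zero_mul, integral_zero, sub_zero, smul_zero]
    refine Asymptotics.IsLittleO.of_bound fun c hc => ?_
    filter_upwards [ht.eventually (Iio_mem_nhds hc)] with r hr
    exact (hle r).trans (mul_le_mul_of_nonneg_right (le_of_lt hr) (norm_nonneg _))
  have h₂ := (hasDerivAt_integral_of_dominated_loc_of_deriv_le (μ := volume) (𝕜 := ℝ)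
    (F := fun r x => u s x * coherent (rotated z r) x)
    (F' := fun r x => u s x * coherentDeriv (rotated z r) x) (x₀ := s) (s := Set.univ)
    (bound := fun x => ‖u s x‖ * ‖D x‖) Filter.univ_mem
    (Filter.Eventually.of_forall fun r => (hui s r).aestronglyMeasurable) (hui s s)
    ((hu.memLp_two s).1.mul (continuous_coherentDeriv _).aestronglyMeasurable)
    (Filter.Eventually.of_forall fun x r _ => by
      rw [norm_mul]; exact mul_le_mul_of_nonneg_left (hder r x) (norm_nonneg _))
    ((hu.memLp_two s).norm.integrable_mul hDmem.norm)
    (Filter.Eventually.of_forall fun x r _ =>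
      (hasDerivAt_coherent_rotated z x r).const_mul (u s x)))
  have h₃ := hu.hasDerivAt_coherent (rotated z s) s
  have hsum := ((h₁.add h₂.2).add h₃).sub_const (∫ x, u s x * coherent (rotated z s) x)
  refine (hsum.congr_of_eventuallyEq (Filter.Eventually.of_forall fun r => ?_)).congr_deriv ?_
  · have e : ∀ x, (u r x - u s x) * (coherent (rotated z r) x - coherent (rotated z s) x) =
        u r x * coherent (rotated z r) x - u s x * coherent (rotated z r) x
          - u r x * coherent (rotated z s) x + u s x * coherent (rotated z s) x := fun x => by ring
    have i₁ : Integrable fun x =>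
        u r x * coherent (rotated z r) x - u s x * coherent (rotated z r) x :=
      (hui r r).sub (hui s r)
    have i₂ : Integrable fun x =>
        u r x * coherent (rotated z r) x - u s x * coherent (rotated z r) x
          - u r x * coherent (rotated z s) x := i₁.sub (hui r s)
    simp only [e, Pi.add_apply]
    rw [integral_add i₂ (hui s s), integral_sub i₁ (hui r s),
      integral_sub (hui r r) (hui s r)]
    ring
  · have hi₂ := h₂.1
    have e : ∀ x, u s x * (coherent (rotated z s) x *
        (d - ∑ j, rotated z s j ^ 2 + 2 * cdot (rotated z s) x)) =
        d * (u s x * coherent (rotated z s) x) +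
          Complex.I * (u s x * coherentDeriv (rotated z s) x) := fun x => by
      rw [coherentDeriv]
      linear_combination (u s x * coherent (rotated z s) x *
        (2 * cdot (rotated z s) x - ∑ j, rotated z s j ^ 2)) * Complex.I_sq
    simp only [e]
    rw [integral_add ((hui s s).const_mul _) (hi₂.const_mul _), integral_const_mul,
      integral_const_mul]
    linear_combination (∫ x, u s x * coherentDeriv (rotated z s) x) * Complex.I_sq

/-- The harmonic Schrödinger flow acts on the Bargmann transform by rotations. -/
theorem IsHarmonicSchrodingerSolution.norm_bargmann_rotated
    (hu : IsHarmonicSchrodingerSolution u₀ u) (z : Fin d → ℂ) (t : ℝ) :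
    ‖bargmann (u t) (rotated z t)‖ = ‖bargmann u₀ z‖ := by
  set g : ℝ → ℂ := fun r => ∫ x, u r x * coherent (rotated z r) x with hg
  have hE : ∀ s : ℝ, HasDerivAt (fun s : ℝ => Complex.exp (-(Complex.I * d) * s))
      (Complex.exp (-(Complex.I * d) * s) * (-(Complex.I * d) * 1)) s := fun s =>
    ((Complex.ofRealCLM.hasDerivAt (x := s)).const_mul (-(Complex.I * d))).cexp
  -- The factor exp(-ids) removes the ground-state phase and makes the pairing constant.
  have hconst : ∀ s : ℝ, HasDerivAt (fun s : ℝ => Complex.exp (-(Complex.I * d) * s) * g s) 0 s :=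
    fun s => ((hE s).fun_mul (hu.hasDerivAt_rotated z s)).congr_deriv (by ring)
  have h := is_const_of_deriv_eq_zero (fun s => (hconst s).differentiableAt)
    (fun s => (hconst s).deriv) t 0
  have h0 : g 0 = bargmann u₀ z := by
    rw [hg, bargmann]
    refine integral_congr_ae ?_
    filter_upwards [hu.initial] with x hx
    have : rotated z 0 = z := by ext j; simp [rotated]
    simp only [hx, this]
  have hn := congrArg norm h
  simp only [norm_mul] at hn
  have h1 : ∀ s : ℝ, ‖Complex.exp (-(Complex.I * d) * s)‖ = 1 := fun s => by
    rw [show -(Complex.I * d) * (s : ℂ) = ((-(d * s) : ℝ) : ℂ) * Complex.I by push_cast; ring]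
    exact Complex.norm_exp_ofReal_mul_I _
  rw [h1, h1, one_mul, one_mul, h0] at hn
  exact hn

theorem IsHarmonicSchrodingerSolution.norm_bargmann
    (hu : IsHarmonicSchrodingerSolution u₀ u) (z : Fin d → ℂ) (t : ℝ) :
    ‖bargmann (u t) z‖ = ‖bargmann u₀ (rotated z (-t))‖ := by
  rw [← hu.norm_bargmann_rotated _ t]
  congr 2
  ext j
  simp [rotated, ← mul_assoc, ← Complex.exp_add]

end Evolution

/-! ### Growth of the Bargmann transform in all complex directions. -/

section Growth

variable {d : ℕ}

theorem tanh_eq_exp (g : ℝ) :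
    Real.tanh g = (1 - Real.exp (-(2 * g))) / (1 + Real.exp (-(2 * g))) := by
  have h : Real.exp (-(2 * g)) = Real.exp (-g) * Real.exp (-g) := by
    rw [← Real.exp_add]; ring_nf
  have h1 : Real.exp g * Real.exp (-g) = 1 := by rw [← Real.exp_add]; simp
  have h2 := Real.exp_pos g
  have h3 := Real.exp_pos (-g)
  rw [Real.tanh_eq_sinh_div_cosh, Real.sinh_eq, Real.cosh_eq, h, div_eq_div_iff (by positivity)
    (by positivity)]
  linear_combination Real.exp (-g) * h1

/-- The Bargmann transform of an integrable function is holomorphic along complex lines. -/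
theorem differentiable_bargmann_line {f : EuclideanSpace ℝ (Fin d) → ℂ} (hf : Integrable f)
    (z₀ z₁ : Fin d → ℂ) : Differentiable ℂ fun w : ℂ => bargmann f fun j => z₀ j + w * z₁ j := by
  intro w₀
  set Z : ℂ → Fin d → ℂ := fun w j => z₀ j + w * z₁ j with hZ
  set c : ℂ → ℂ := fun w => (∑ j, Z w j * z₁ j) / 2 with hc
  set R : ℝ := ‖w₀‖ + 1 with hR
  set S : ℝ := (∑ j, ‖z₀ j‖) + R * ∑ j, ‖z₁ j‖ with hS
  set T : ℝ := ∑ j, ‖z₁ j‖ with hT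
  have hT0 : 0 ≤ T := Finset.sum_nonneg fun j _ => norm_nonneg _
  have hS0 : 0 ≤ S := by
    have : 0 ≤ ∑ j, ‖z₀ j‖ := Finset.sum_nonneg fun j _ => norm_nonneg _
    positivity
  have hZS : ∀ w ∈ Metric.ball w₀ 1, ∑ j, ‖Z w j‖ ≤ S := fun w hw => by
    have hwR : ‖w‖ ≤ R := by
      have h1 := norm_le_norm_add_norm_sub' w w₀
      rw [mem_ball_iff_norm] at hw
      linarith
    rw [hS, Finset.mul_sum, ← Finset.sum_add_distrib]
    refine Finset.sum_le_sum fun j _ => (norm_add_le _ _).trans ?_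
    rw [norm_mul]
    gcongr
  have hder : ∀ x w, HasDerivAt (fun w => f x * coherent (Z w) x)
      (f x * (coherent (Z w) x * (cdot z₁ x - c w))) w := fun x w => by
    have hZd : ∀ j, HasDerivAt (fun w => Z w j) (z₁ j) w := fun j =>
      (((hasDerivAt_id w).mul_const (z₁ j)).const_add (z₀ j)).congr_deriv (one_mul _)
    have h1 : HasDerivAt (fun w => cdot (Z w) x) (cdot z₁ x) w :=
      HasDerivAt.fun_sum fun j _ => (hZd j).mul_const (x j : ℂ)
    have h2 : HasDerivAt (fun w => (∑ j, Z w j ^ 2) / 4) (c w) w := by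
      refine ((HasDerivAt.fun_sum (u := Finset.univ) fun j _ =>
        (hZd j).fun_pow 2).div_const 4).congr_deriv ?_
      simp only [hc, Nat.add_one_sub_one, pow_one, Nat.cast_ofNat, mul_assoc, ← Finset.mul_sum]
      ring
    exact (((h1.sub_const ((‖x‖ : ℂ) ^ 2 / 2)).fun_sub h2).cexp).const_mul (f x)
  have hbound : ∀ x, ∀ w ∈ Metric.ball w₀ 1,
      ‖f x * (coherent (Z w) x * (cdot z₁ x - c w))‖ ≤
        ‖f x‖ * (Real.exp (2 * S ^ 2) * (T * (S + 4))) := fun x w hw => by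
    have hSw := hZS w hw
    have h1 : ‖cdot z₁ x - c w‖ ≤ T * (S + (1 + ‖x‖)) := by
      refine (norm_sub_le _ _).trans ?_
      have h2 := norm_cdot_le z₁ x
      have h3 : ‖c w‖ ≤ S * T := by
        rw [hc, norm_div, Complex.norm_ofNat]
        refine (div_le_self (norm_nonneg _) (by norm_num)).trans ?_
        exact (norm_sum_mul_le (Z w) z₁).trans (mul_le_mul_of_nonneg_right hSw hT0)
      nlinarith [norm_nonneg x]
    have h4 : (1 + ‖x‖) * Real.exp (-(1 / 4) * ‖x‖ ^ 2) ≤ 4 := by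
      have h5 := Real.add_one_le_exp (1 / 4 * ‖x‖ ^ 2)
      rw [neg_mul, Real.exp_neg, ← div_eq_mul_inv, div_le_iff₀ (Real.exp_pos _)]
      nlinarith [sq_nonneg (‖x‖ - 1)]
    have h6 : Real.exp (-(1 / 4) * ‖x‖ ^ 2) ≤ 1 :=
      Real.exp_le_one_iff.2 (by nlinarith [sq_nonneg ‖x‖])
    rw [norm_mul, norm_mul]
    refine mul_le_mul_of_nonneg_left ?_ (norm_nonneg _)
    calc ‖coherent (Z w) x‖ * ‖cdot z₁ x - c w‖
        ≤ (Real.exp (2 * S ^ 2) * Real.exp (-(1 / 4) * ‖x‖ ^ 2)) * (T * (S + (1 + ‖x‖))) :=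
          mul_le_mul (norm_coherent_le_gaussian _ hSw x) h1 (norm_nonneg _) (by positivity)
      _ = Real.exp (2 * S ^ 2) * (T * (S * Real.exp (-(1 / 4) * ‖x‖ ^ 2) +
            (1 + ‖x‖) * Real.exp (-(1 / 4) * ‖x‖ ^ 2))) := by ring
      _ ≤ Real.exp (2 * S ^ 2) * (T * (S + 4)) := by
          gcongr
          exact mul_le_of_le_one_right hS0 h6
  have hci : ∀ w, Continuous fun x => coherent (Z w) x * (cdot z₁ x - c w) := fun w => by
    fun_prop
  exact (hasDerivAt_integral_of_dominated_loc_of_deriv_le (μ := volume) (𝕜 := ℂ)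
    (F := fun w x => f x * coherent (Z w) x) (x₀ := w₀) (s := Metric.ball w₀ 1)
    (bound := fun x => ‖f x‖ * (Real.exp (2 * S ^ 2) * (T * (S + 4))))
    (Metric.ball_mem_nhds w₀ one_pos)
    (Filter.Eventually.of_forall fun w => (hf.mul_coherent _).aestronglyMeasurable)
    (hf.mul_coherent _) (hf.aestronglyMeasurable.mul (hci w₀).aestronglyMeasurable)
    (Filter.Eventually.of_forall hbound) (hf.norm.mul_const _)
    (Filter.Eventually.of_forall fun x w _ => hder x w)).2.differentiableAt

theorem reVec_mul_ofReal (w : ℂ) (s : EuclideanSpace ℝ (Fin d)) :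
    reVec (fun j => w * (s j : ℂ)) = w.re • s := by
  ext j; simp [reVec]

theorem imVec_mul_ofReal (w : ℂ) (s : EuclideanSpace ℝ (Fin d)) :
    imVec (fun j => w * (s j : ℂ)) = w.im • s := by
  ext j; simp [imVec]

theorem norm_reVec_rotated_add (z : Fin d → ℂ) (t : ℝ) :
    ‖reVec (rotated z t)‖ ^ 2 + ‖imVec (rotated z t)‖ ^ 2 = ‖reVec z‖ ^ 2 + ‖imVec z‖ ^ 2 := by
  rw [norm_sq_reVec_add_imVec, norm_sq_reVec_add_imVec]
  simp only [rotated, norm_mul, norm_exp_mul_I_ofReal, one_mul]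

variable {f : EuclideanSpace ℝ (Fin d) → ℂ} {M β : ℝ}

/-- Along complexified real lines the Bargmann transform has the optimal growth rate. -/
theorem norm_bargmann_mul_ofReal_le (hf : Integrable f) (hβ : 0 < β) (hβ1 : β < 1)
    (h₁ : ∀ z, ‖bargmann f z‖ ≤ M * Real.exp ((β ^ 2 * ‖reVec z‖ ^ 2 + ‖imVec z‖ ^ 2) / 4))
    (h₂ : ∀ z, ‖bargmann f z‖ ≤ M * Real.exp ((‖reVec z‖ ^ 2 + β ^ 2 * ‖imVec z‖ ^ 2) / 4))
    (w : ℂ) (s : EuclideanSpace ℝ (Fin d)) :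
    ‖bargmann f (fun j => w * (s j : ℂ))‖ ≤ M * Real.exp (β * ‖w‖ ^ 2 * ‖s‖ ^ 2 / 4) := by
  have hdiff : Differentiable ℂ fun w : ℂ => bargmann f fun j => w * (s j : ℂ) := by
    simpa using differentiable_bargmann_line hf 0 (fun j => (s j : ℂ))
  refine (norm_le_of_quadratic_bounds hdiff (M := M) (k := ‖s‖ ^ 2 / 4) (by positivity) hβ hβ1
    (fun v => ?_) (fun v => ?_) w).trans (le_of_eq ?_)
  · refine (h₁ _).trans (le_of_eq ?_)
    rw [reVec_mul_ofReal, imVec_mul_ofReal, norm_smul, norm_smul, mul_pow, mul_pow,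
      Real.norm_eq_abs, Real.norm_eq_abs, sq_abs, sq_abs]
    ring_nf
  · refine (h₂ _).trans (le_of_eq ?_)
    rw [reVec_mul_ofReal, imVec_mul_ofReal, norm_smul, norm_smul, mul_pow, mul_pow,
      Real.norm_eq_abs, Real.norm_eq_abs, sq_abs, sq_abs]
    ring_nf
  · ring_nf

/-- Growth in general complex directions, by the maximum principle on the disc of vectors
`η a + conj a` whose boundary consists of rotated real vectors. -/
theorem norm_bargmann_rotated_le_of_disc (hf : Integrable f)
    (h : ∀ (w : ℂ) (s : EuclideanSpace ℝ (Fin d)),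
      ‖bargmann f (fun j => w * (s j : ℂ))‖ ≤ M * Real.exp (β * ‖w‖ ^ 2 * ‖s‖ ^ 2 / 4))
    (z : Fin d → ℂ) (t : ℝ) :
    ‖bargmann f (rotated z t)‖ ≤
      M * Real.exp ((8 / 5 * β * ‖reVec z‖ ^ 2 + 8 / 3 * β * ‖imVec z‖ ^ 2) / 4) := by
  set ζ := Complex.exp (-2 * Complex.I * t) with hζ
  have hζ1 : ‖ζ‖ = 1 := norm_exp_mul_I_ofReal t
  set a : Fin d → ℂ := fun j => ⟨4 / 5 * (z j).re, -(4 / 3 * (z j).im)⟩ with ha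
  -- In this proof κ is the sum of the a_j², not a growth coefficient. The choice of a makes conj a
  -- + a/4 equal to z: its parts are 5/4 Re a and -3/4 Im a.
  set κ : ℂ := ∑ j, a j ^ 2 with hκ
  set N : ℝ := ∑ j, ‖a j‖ ^ 2 with hN
  set V : ℂ → Fin d → ℂ := fun η j => ζ * (starRingEnd ℂ) (a j) + η * (ζ * a j) with hV
  set g : ℂ → ℂ := fun η => bargmann f (V η) * Complex.exp (-(β / 2 * κ) * η) with hg
  have hgd : Differentiable ℂ g :=
    (differentiable_bargmann_line hf (fun j => ζ * (starRingEnd ℂ) (a j)) fun j => ζ * a j).mul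
      (by fun_prop)
  have hexp : ∀ η : ℂ, ‖Complex.exp (-(β / 2 * κ) * η)‖ = Real.exp (-(β / 2) * (κ * η).re) :=
    fun η => by
      rw [Complex.norm_exp]
      congr 1
      rw [show -((β : ℂ) / 2 * κ) * η = ((-(β / 2) : ℝ) : ℂ) * (κ * η) by push_cast; ring,
        Complex.re_ofReal_mul]
  have hcirc : ∀ η : ℂ, ‖η‖ = 1 → ‖g η‖ ≤ M * Real.exp (β / 2 * N) := fun η hη => by
    -- With η = ξ² and |ξ| = 1, conj a + ηa = ξ · 2Re(ξa) is a multiple of a real vector s with |s|²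
    -- = 2N + 2Re(κη). The multiplier in g cancels the term in κη, leaving a constant bound on the
    -- circle.
    obtain ⟨ξ, hξ⟩ : ∃ ξ : ℂ, ξ ^ 2 = η := IsAlgClosed.exists_pow_nat_eq η two_pos
    have hξ1 : ‖ξ‖ = 1 := by
      have h1 : ‖ξ‖ ^ 2 = 1 := by rw [← norm_pow, hξ, hη]
      exact (pow_eq_one_iff_of_nonneg (norm_nonneg _) two_ne_zero).1 h1
    set s : EuclideanSpace ℝ (Fin d) := WithLp.toLp 2 fun j => 2 * (ξ * a j).re with hs
    have hsj : ∀ j, ((s j : ℝ) : ℂ) = ξ * a j + (starRingEnd ℂ) (ξ * a j) := fun j => by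
      rw [Complex.add_conj]
    have hξξ : ξ * (starRingEnd ℂ) ξ = 1 := by
      rw [Complex.mul_conj, Complex.normSq_eq_norm_sq, hξ1]; simp
    have hVs : V η = fun j => ζ * ξ * (s j : ℂ) := by
      ext j
      rw [hsj, hV, ← hξ, map_mul]
      linear_combination (-(ζ * (starRingEnd ℂ) (a j))) * hξξ
    have hsn : ‖s‖ ^ 2 = 2 * N + 2 * (κ * η).re := by
      rw [EuclideanSpace.norm_sq_eq, hN, hκ, Finset.sum_mul, Complex.re_sum, Finset.mul_sum,
        Finset.mul_sum, ← Finset.sum_add_distrib]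
      refine Finset.sum_congr rfl fun j _ => ?_
      have e1 : a j ^ 2 * η = (ξ * a j) ^ 2 := by rw [← hξ]; ring
      have e2 : ‖a j‖ ^ 2 = ‖ξ * a j‖ ^ 2 := by rw [norm_mul, hξ1, one_mul]
      rw [e1, e2, Complex.sq_norm, Complex.normSq_apply, Real.norm_eq_abs, sq_abs, pow_two (ξ * a j),
        Complex.mul_re (ξ * a j) (ξ * a j)]
      simp only [hs]
      ring
    rw [hg, norm_mul, hexp, hVs]
    refine (mul_le_mul_of_nonneg_right (h _ s) (Real.exp_pos _).le).trans (le_of_eq ?_)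
    rw [mul_assoc, ← Real.exp_add, norm_mul, hζ1, hξ1, hsn]
    ring_nf
  have hmax : ‖g (1 / 4)‖ ≤ M * Real.exp (β / 2 * N) := by
    refine Complex.norm_le_of_forall_mem_frontier_norm_le (U := Metric.ball (0 : ℂ) 1)
      Metric.isBounded_ball hgd.diffContOnCl (fun η hη => hcirc η ?_) (subset_closure ?_)
    · rw [frontier_ball _ one_ne_zero] at hη
      simpa using hη
    · rw [mem_ball_zero_iff]; norm_num
  have hVz : V (1 / 4) = rotated z t := by
    ext j
    simp only [hV, rotated, ← hζ]
    rw [mul_left_comm, ← mul_add]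
    congr 1
    apply Complex.ext
    · simp [ha]; ring
    · simp [ha]; ring
  have hNeq : N = 16 / 25 * ‖reVec z‖ ^ 2 + 16 / 9 * ‖imVec z‖ ^ 2 := by
    rw [hN, norm_sq_reVec, norm_sq_imVec, Finset.mul_sum, Finset.mul_sum,
      ← Finset.sum_add_distrib]
    refine Finset.sum_congr rfl fun j _ => ?_
    rw [Complex.sq_norm, Complex.normSq_apply]
    simp only [ha]
    ring
  have hκeq : κ.re = 16 / 25 * ‖reVec z‖ ^ 2 - 16 / 9 * ‖imVec z‖ ^ 2 := by
    rw [hκ, norm_sq_reVec, norm_sq_imVec, Finset.mul_sum, Finset.mul_sum,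
      ← Finset.sum_sub_distrib, Complex.re_sum]
    refine Finset.sum_congr rfl fun j _ => ?_
    rw [pow_two, Complex.mul_re]
    simp only [ha]
    ring
  have hκ4 : (κ * (1 / 4)).re = κ.re / 4 := by
    rw [show κ * (1 / 4) = κ / ((4 : ℝ) : ℂ) by push_cast; ring, Complex.div_ofReal_re]
  rw [hg, norm_mul, hexp, hVz, hκ4] at hmax
  calc ‖bargmann f (rotated z t)‖ = ‖bargmann f (rotated z t)‖ *
        Real.exp (-(β / 2) * (κ.re / 4)) * Real.exp (β / 2 * (κ.re / 4)) := by
        rw [mul_assoc, ← Real.exp_add]; simp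
    _ ≤ M * Real.exp (β / 2 * N) * Real.exp (β / 2 * (κ.re / 4)) :=
        mul_le_mul_of_nonneg_right hmax (Real.exp_pos _).le
    _ = _ := by
        rw [mul_assoc, ← Real.exp_add, hNeq, hκeq]
        ring_nf

/-- Anisotropic growth of all rotations of the Bargmann transform. -/
theorem exists_norm_bargmann_rotated_le (hd : 1 ≤ d) {γ : ℝ} (hγ : 0 < γ) :
    ∃ κ < (1 : ℝ), ∀ (M : ℝ) (f : EuclideanSpace ℝ (Fin d) → ℂ), Integrable f →
      (∀ z, ‖bargmann f z‖ ≤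
        M * Real.exp ((Real.exp (-(2 * γ)) ^ 2 * ‖reVec z‖ ^ 2 + ‖imVec z‖ ^ 2) / 4)) →
      (∀ z, ‖bargmann f z‖ ≤
        M * Real.exp ((‖reVec z‖ ^ 2 + Real.exp (-(2 * γ)) ^ 2 * ‖imVec z‖ ^ 2) / 4)) →
      ∀ z t, ‖bargmann f (rotated z t)‖ ≤
        M * Real.exp ((Real.exp (-(2 * (γ / d))) * ‖reVec z‖ ^ 2 + κ * ‖imVec z‖ ^ 2) / 4) := by
  set β := Real.exp (-(2 * γ)) with hβ_def
  have hβ : 0 < β := Real.exp_pos _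
  have hβ1 : β < 1 := Real.exp_lt_one_iff.2 (by linarith)
  have mono : ∀ {M x y X : ℝ}, X ≤ M * Real.exp x → 0 ≤ X → x ≤ y → X ≤ M * Real.exp y := by
    intro M x y X hX hX0 hxy
    have hM : 0 ≤ M := nonneg_of_mul_nonneg_left (hX0.trans hX) (Real.exp_pos x)
    exact hX.trans (mul_le_mul_of_nonneg_left (Real.exp_le_exp.2 hxy) hM)
  rcases hd.eq_or_lt with rfl | hd2
  · refine ⟨β, hβ1, fun M f hf h₁ h₂ z t => ?_⟩
    have h := norm_bargmann_mul_ofReal_le hf hβ hβ1 h₁ h₂ (rotated z t 0)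
      (EuclideanSpace.single 0 1)
    have e : (fun j => rotated z t 0 * ((EuclideanSpace.single 0 1 : EuclideanSpace ℝ (Fin 1)) j : ℂ))
        = rotated z t := by
      ext j
      fin_cases j
      simp
    rw [e] at h
    refine mono h (norm_nonneg _) (le_of_eq ?_)
    have h3 := norm_sq_reVec_add_imVec (rotated z t)
    rw [norm_reVec_rotated_add, Fin.sum_univ_one] at h3
    rw [← h3]
    simp [← hβ_def]
    ring
  · set ρ := Real.exp (-γ) with hρ_def
    have hρ : 0 < ρ := Real.exp_pos _
    have hρ1 : ρ < 1 := Real.exp_lt_one_iff.2 (by linarith)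
    have hβρ : β = ρ ^ 2 := by rw [hβ_def, hρ_def, ← Real.exp_nat_mul]; ring_nf
    have hρb : ρ ≤ Real.exp (-(2 * (γ / d))) := by
      refine Real.exp_le_exp.2 (neg_le_neg ?_)
      have hd2' : (2 : ℝ) ≤ d := by exact_mod_cast hd2
      rw [← mul_div_assoc, div_le_iff₀ (by linarith)]
      nlinarith
    -- At 3/5 both regimes work: for ρ ≤ 3/5, 8β/3 ≤ 24/25 < 1 and 8β/5 ≤ ρ; for ρ > 3/5, ρ³ + ρ² +
    -- ρ > 1.
    by_cases hsmall : ρ ≤ 3 / 5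
    · refine ⟨8 / 3 * β, by nlinarith, fun M f hf h₁ h₂ z t => ?_⟩
      refine mono (norm_bargmann_rotated_le_of_disc hf
        (norm_bargmann_mul_ofReal_le hf hβ hβ1 h₁ h₂) z t) (norm_nonneg _) ?_
      have h3 : 8 / 5 * β ≤ Real.exp (-(2 * (γ / d))) := by nlinarith
      have := mul_le_mul_of_nonneg_right h3 (sq_nonneg ‖reVec z‖)
      linarith
    · push Not at hsmall
      refine ⟨(1 + β ^ 2) / 2, by nlinarith, fun M f hf h₁ h₂ z t => ?_⟩
      have h3 : (1 + β ^ 2) / 2 ≤ Real.exp (-(2 * (γ / d))) := by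
        refine le_trans ?_ hρb
        -- This product equals 2ρ - 1 - ρ⁴, and β² = ρ⁴.
        have h4 : 0 ≤ (1 - ρ) * (ρ ^ 3 + ρ ^ 2 + ρ - 1) := by
          refine mul_nonneg (by linarith) ?_
          nlinarith [mul_pos hρ hρ, mul_pos (mul_pos hρ hρ) hρ,
            mul_pos (sub_pos.2 hsmall) (sub_pos.2 hsmall),
            mul_pos (mul_pos hρ hρ) (sub_pos.2 hsmall)]
        rw [hβρ]
        nlinarith
      have h5 : ‖bargmann f (rotated z t)‖ ≤
          M * Real.exp ((1 + β ^ 2) / 2 * (‖reVec z‖ ^ 2 + ‖imVec z‖ ^ 2) / 4) := by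
        rw [← norm_reVec_rotated_add z t]
        have hβ2 : 0 < 1 - β ^ 2 := by nlinarith
        -- The bound that puts the gain β² on the larger of the two parts is at most the one with
        -- their average coefficient.
        rcases le_total (‖reVec (rotated z t)‖ ^ 2) (‖imVec (rotated z t)‖ ^ 2) with hle | hle
        · refine mono (h₂ (rotated z t)) (norm_nonneg _) ?_
          nlinarith [mul_nonneg hβ2.le (sub_nonneg.2 hle)]
        · refine mono (h₁ (rotated z t)) (norm_nonneg _) ?_
          nlinarith [mul_nonneg hβ2.le (sub_nonneg.2 hle)]
      refine mono h5 (norm_nonneg _) ?_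
      have := mul_le_mul_of_nonneg_right h3 (sq_nonneg ‖reVec z‖)
      linarith

end Growth

/-! ### Hardy class data in Bargmann form, and Fourier transforms as rotations. -/

section HardyClass

variable {d : ℕ}

theorem norm_sq_reVec_I_mul (z : Fin d → ℂ) :
    ‖reVec fun j => Complex.I * z j‖ ^ 2 = ‖imVec z‖ ^ 2 := by
  rw [norm_sq_reVec, norm_sq_imVec]; simp

theorem norm_sq_imVec_I_mul (z : Fin d → ℂ) :
    ‖imVec fun j => Complex.I * z j‖ ^ 2 = ‖reVec z‖ ^ 2 := by
  rw [norm_sq_reVec, norm_sq_imVec]; simp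

theorem tanh_two_mul_eq (γ : ℝ) : Real.tanh (2 * γ) =
    (1 - Real.exp (-(2 * γ)) ^ 2) / (1 + Real.exp (-(2 * γ)) ^ 2) := by
  rw [tanh_eq_exp, ← Real.exp_nat_mul]
  ring_nf

/-- For β = exp(-2γ), 1 + tanh 2γ = 2/(1+β²), which turns the coefficient of |Re z|² into exactly
β²/4. -/
theorem norm_bargmann_le_of_tanh {γ A : ℝ} {f : EuclideanSpace ℝ (Fin d) → ℂ}
    (hf : ∀ᵐ x, ‖f x‖ ≤ A * Real.exp (-(Real.tanh (2 * γ) * ‖x‖ ^ 2 / 2))) (z : Fin d → ℂ) :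
    ‖bargmann f z‖ ≤ (2 * Real.pi / (1 + Real.tanh (2 * γ))) ^ ((d : ℝ) / 2) * A *
      Real.exp ((Real.exp (-(2 * γ)) ^ 2 * ‖reVec z‖ ^ 2 + ‖imVec z‖ ^ 2) / 4) := by
  refine (norm_bargmann_le (Real.neg_one_lt_tanh _) hf z).trans (le_of_eq ?_)
  congr 2
  rw [tanh_two_mul_eq]
  have h := Real.exp_pos (-(2 * γ))
  field_simp
  ring

theorem InHardyClass.norm_bargmann_le {γ A : ℝ} {f : EuclideanSpace ℝ (Fin d) → ℂ}
    (hf : InHardyClass (Real.tanh (2 * γ)) A f) (z : Fin d → ℂ) :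
    ‖bargmann f z‖ ≤ (2 * Real.pi / (1 + Real.tanh (2 * γ))) ^ ((d : ℝ) / 2) * A *
      Real.exp ((‖reVec z‖ ^ 2 + Real.exp (-(2 * γ)) ^ 2 * ‖imVec z‖ ^ 2) / 4) := by
  have h := norm_bargmann_le_of_tanh (Filter.Eventually.of_forall hf.fourier_bound)
    fun j => Complex.I * z j
  have e : (fun j => -Complex.I * (Complex.I * z j)) = z := by
    ext j
    linear_combination -z j * Complex.I_sq
  rw [bargmann_unitaryFourier hf.integrable, e, norm_sq_reVec_I_mul, norm_sq_imVec_I_mul] at h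
  rwa [add_comm (‖reVec z‖ ^ 2)]

theorem InHardyClass.nonneg {a A : ℝ} {f : EuclideanSpace ℝ (Fin d) → ℂ}
    (hf : InHardyClass a A f) : 0 ≤ A :=
  nonneg_of_mul_nonneg_left ((norm_nonneg _).trans (hf.fourier_bound 0)) (Real.exp_pos _)

theorem rotated_rotated (z : Fin d → ℂ) (s t : ℝ) :
    rotated (rotated z s) t = rotated z (s + t) := by
  ext j
  simp only [rotated]
  rw [← mul_assoc, ← Complex.exp_add]
  push_cast
  ring_nf

/-- On the Bargmann side the Fourier transform is a rotation of the same family as the flow, so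
bounds over all angles also cover the transform of u. -/
theorem neg_I_mul_eq_rotated (z : Fin d → ℂ) :
    (fun j => -Complex.I * z j) = rotated z (Real.pi / 4) := by
  ext j
  rw [rotated, show -2 * Complex.I * ((Real.pi / 4 : ℝ) : ℂ) = -(Real.pi / 2 * Complex.I) by
    push_cast; ring, Complex.exp_neg, Complex.exp_pi_div_two_mul_I, Complex.inv_I]

theorem norm_unitaryFourier_le (f : EuclideanSpace ℝ (Fin d) → ℂ)
    (ξ : EuclideanSpace ℝ (Fin d)) :
    ‖unitaryFourier f ξ‖ ≤ (2 * Real.pi) ^ (-((d : ℝ) / 2)) * ∫ x, ‖f x‖ := by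
  rw [unitaryFourier, norm_mul, Complex.norm_real, Real.norm_of_nonneg (by positivity)]
  refine mul_le_mul_of_nonneg_left ((norm_integral_le_integral_norm _).trans (le_of_eq ?_))
    (by positivity)
  refine integral_congr_ae (Filter.Eventually.of_forall fun x => ?_)
  simp only
  rw [norm_mul, Complex.norm_exp]
  simp

theorem integrable_unitaryFourier_mul_coherent {f : EuclideanSpace ℝ (Fin d) → ℂ}
    (hf : Integrable f) (z : Fin d → ℂ) :
    Integrable fun x => unitaryFourier f x * coherent z x :=
  (integrable_coherent z).bdd_mul (continuous_unitaryFourier hf).aestronglyMeasurable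
    (Filter.Eventually.of_forall (norm_unitaryFourier_le f))

/-- An almost everywhere bound between continuous functions holds everywhere. -/
theorem forall_le_of_ae_le {F G : EuclideanSpace ℝ (Fin d) → ℝ} (hF : Continuous F)
    (hG : Continuous G) (h : ∀ᵐ x, F x ≤ G x) (x : EuclideanSpace ℝ (Fin d)) : F x ≤ G x := by
  have hcl : IsClosed {x | F x ≤ G x} := isClosed_le hF hG
  exact hcl.closure_subset_iff.2 subset_rfl (Measure.dense_of_ae h x)

end HardyClass

/-! ### The main theorem. -/

theorem theorem3p3 (d : ℕ) (hd : 1 ≤ d) (γ : ℝ) (hγ : 0 < γ) :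
    ∃ K : ℝ, 0 < K ∧
      ∀ (A : ℝ) (u₀ : EuclideanSpace ℝ (Fin d) → ℂ), InHardyClass (Real.tanh (2 * γ)) A u₀ →
      ∀ u : ℝ → EuclideanSpace ℝ (Fin d) → ℂ, IsHarmonicSchrodingerSolution u₀ u →
      ∀ t : ℝ,
        (∀ᵐ x ∂(volume : Measure (EuclideanSpace ℝ (Fin d))),
          ‖u t x‖ ≤ K * A * (max 1 ‖x‖) ^ (((d : ℝ) - 1) / (2 * (d : ℝ)))
            * Real.exp (-(Real.tanh (γ / (d : ℝ)) * ‖x‖ ^ 2 / 2))) ∧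
        Integrable (u t) volume ∧
        ∀ ξ : EuclideanSpace ℝ (Fin d),
          ‖unitaryFourier (u t) ξ‖ ≤
            K * A * (max 1 ‖ξ‖) ^ (((d : ℝ) - 1) / (2 * (d : ℝ)))
              * Real.exp (-(Real.tanh (γ / (d : ℝ)) * ‖ξ‖ ^ 2 / 2)) := by
  obtain ⟨κ, hκ, hgrowth⟩ := exists_norm_bargmann_rotated_le hd hγ
  have hd0 : (1 : ℝ) ≤ d := by exact_mod_cast hd
  have hκ' : 0 < 1 - κ := by linarith
  have htanh : 0 < 1 + Real.tanh (2 * γ) := by linarith [Real.neg_one_lt_tanh (2 * γ)]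
  set C := (2 * Real.pi / (1 + Real.tanh (2 * γ))) ^ ((d : ℝ) / 2) with hC
  have hC0 : 0 < C := by positivity
  set B := (Real.pi * (1 - κ)) ^ (-((d : ℝ) / 2)) with hB
  have hB0 : 0 < B := by positivity
  refine ⟨B * C, by positivity, fun A u₀ hu₀ u hu t => ?_⟩
  have hA : 0 ≤ A := hu₀.nonneg
  have hrot := hgrowth (C * A) u₀ hu₀.integrable (norm_bargmann_le_of_tanh hu₀.bound)
    hu₀.norm_bargmann_le
  have hdecay : ∀ v : EuclideanSpace ℝ (Fin d) → ℂ,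
      (∀ z, Integrable fun x => v x * coherent z x) →
      (∀ z, ∃ s, ‖bargmann v z‖ = ‖bargmann u₀ (rotated z s)‖) →
      ∀ᵐ x, ‖v x‖ ≤ B * C * A * Real.exp (-(Real.tanh (γ / d) * ‖x‖ ^ 2 / 2)) := by
    intro v hv hvr
    have h := norm_le_of_bargmann_bound (M := C * A) (Real.exp_pos (-(2 * (γ / d)))).le hκ hv
      fun z => by
        obtain ⟨s, hs⟩ := hvr z
        rw [hs]
        exact hrot z s
    rw [tanh_eq_exp]
    simpa only [mul_assoc] using h
  -- The estimate holds without the polynomial factor, which is at least 1 because its exponent is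
  -- nonnegative.
  have hpoly : ∀ x : EuclideanSpace ℝ (Fin d),
      B * C * A * Real.exp (-(Real.tanh (γ / d) * ‖x‖ ^ 2 / 2)) ≤
      B * C * A * (max 1 ‖x‖) ^ (((d : ℝ) - 1) / (2 * (d : ℝ)))
        * Real.exp (-(Real.tanh (γ / (d : ℝ)) * ‖x‖ ^ 2 / 2)) := fun x => by
    refine mul_le_mul_of_nonneg_right (le_mul_of_one_le_right (by positivity) ?_)
      (Real.exp_pos _).le
    exact Real.one_le_rpow (le_max_left _ _)
      (div_nonneg (by linarith) (by linarith))
  have hut := hdecay (u t) (fun z => (hu.memLp_two t).integrable_mul_coherent z)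
    fun z => ⟨-t, hu.norm_bargmann z t⟩
  have hut_int : Integrable (u t) := by
    have hpos : 0 < Real.tanh (γ / d) / 2 := half_pos (by
      rw [Real.tanh_eq_sinh_div_cosh]
      exact div_pos (Real.sinh_pos_iff.2 (by positivity)) (Real.cosh_pos _))
    refine ((integrable_exp_neg_mul_norm_sq (d := d) hpos).const_mul (B * C * A)).mono'
      (hu.memLp_two t).1 ?_
    filter_upwards [hut] with x hx
    refine hx.trans (le_of_eq ?_)
    ring_nf
  refine ⟨hut.mono fun x hx => hx.trans (hpoly x), hut_int, fun ξ => ?_⟩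
  have hft := hdecay (unitaryFourier (u t)) (integrable_unitaryFourier_mul_coherent hut_int)
    fun z => ⟨Real.pi / 4 + -t, by
      rw [bargmann_unitaryFourier hut_int, neg_I_mul_eq_rotated, hu.norm_bargmann, rotated_rotated]⟩
  -- The transform of an integrable function is continuous, so its almost everywhere bound holds at
  -- every ξ.
  exact (forall_le_of_ae_le (continuous_unitaryFourier hut_int).norm (by fun_prop) hft ξ).trans
    (hpoly ξ)
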